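/- Let $d\ge 1$, let $\mathbb K$ be a number field, and let $A(\mathbb K)$ be the (countable, discrete) group of invertible upper triangular $d\times d$ matrices over $\mathbb K$. For a place $v$ of $\mathbb K$ (a non-zero prime ideal of the ring of integers or an archimedean place) let $|\cdot|_v$ be the normalized absolute value and $\mathbb K_v$ the completion, and let $B_v=GL_d(\mathbb K_v)/\overline A(\mathbb K_v)$ be the space of complete flags of $\mathbb K_v^d$, where $\overline A$ is the group of invertible lower triangular matrices. Let $\mathbf B=\prod_v B_v$ be the product over all places, with the product topology, its Borel $\sigma$-algebra and the diagonal action of $A(\mathbb K)$. Let $\mu$ be a probability measure on $A(\mathbb K)$ such that, for every place $v$, $\ln|a_{i,i}|_v$ is $\mu$-integrable for all $i$ and $\ln^+|a_{i,j}|_v$ is $\mu$-integrable for all $i<j$ (where $\ln^+ t=\max(0,\ln t)$, $\ln^+0=0$). Put $\phi_v(i)=\int\ln|a_{i,i}|_v\,d\mu(a)$, let $w_v$ be the unique permutation of $\{1,\dots,d\}$ such that, for all $i<j$, $w_v(i)>w_v(j)$ if and only if $\phi_v(i)\ge\phi_v(j)$, and let $C_v(\mu)=A(\mathbb K_v)\,w_v\,\overline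 A(\mathbb K_v)/\overline A(\mathbb K_v)\subset B_v$ be the corresponding Bruhat cell, where $w_v$ is identified with the permutation matrix having entries $1$ at the places $(i,w_v(i))$. Then there is a Borel probability measure $\nu$ on $\mathbf B$, with $\nu$-almost every point lying in $\prod_v C_v(\mu)$, such that $(\mathbf B,\nu)$ is a $\mu$-boundary: $\nu$ is $\mu$-stationary, i.e. $\int g\nu\,d\mu(g)=\nu$, and if $(g_n)_{n\ge1}$ are i.i.d. of law $\mu$ and $x_n=g_1\cdots g_n$, then almost surely $x_n\nu$ converges weakly to a Dirac measure on $\mathbf B$. -/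

import Mathlib

open MeasureTheory Filter Topology NumberField IsDedekindDomain
open scoped Matrix

noncomputable section

/-! ### Triangular groups and flag manifolds over a field -/

/-- The group `A(F)` of invertible upper triangular matrices of size `d` over a field `F`
(the diagonal coefficients are then automatically non-zero). -/
def upperTriangular (d : ℕ) (F : Type*) [Field F] : Subgroup (GL (Fin d) F) where
  carrier := {g | ∀ i j : Fin d, j < i → (g : Matrix (Fin d) (Fin d) F) i j = 0}
  one_mem' := by
    intro i j hij
    simp [hij.ne']
  mul_mem' := by
    intro a b ha hb
    have := Matrix.BlockTriangular.mul (b := (id : Fin d → Fin d)) (M := a.1) (N := b.1)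
      (fun i j h => ha i j h) (fun i j h => hb i j h)
    exact fun i j h => this h
  inv_mem' := by
    intro a ha
    let _ : Invertible a.1 := a.invertible
    have := Matrix.blockTriangular_inv_of_blockTriangular (b := (id : Fin d → Fin d)) (M := a.1)
      (fun i j h => ha i j h)
    intro i j h
    rw [Matrix.coe_units_inv]
    exact this h

/-- The group `Ā(F)` of invertible lower triangular matrices of size `d` over a field `F`. -/
def lowerTriangular (d : ℕ) (F : Type*) [Field F] : Subgroup (GL (Fin d) F) where
  carrier := {g | ∀ i j : Fin d, i < j → (g : Matrix (Fin d) (Fin d) F) i j = 0}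
  one_mem' := by
    intro i j hij
    simp [hij.ne]
  mul_mem' := by
    intro a b ha hb
    have := Matrix.BlockTriangular.mul (b := (OrderDual.toDual : Fin d → (Fin d)ᵒᵈ))
      (M := a.1) (N := b.1) (fun i j h => ha i j h) (fun i j h => hb i j h)
    exact fun i j h => this (OrderDual.toDual_lt_toDual.2 h)
  inv_mem' := by
    intro a ha
    let _ : Invertible a.1 := a.invertible
    have := Matrix.blockTriangular_inv_of_blockTriangular
      (b := (OrderDual.toDual : Fin d → (Fin d)ᵒᵈ)) (M := a.1) (fun i j h => ha i j h)
    intro i j h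
    rw [Matrix.coe_units_inv]
    exact this (OrderDual.toDual_lt_toDual.2 h)

/-- The space of complete flags in `F ^ d`, as the homogeneous space `GL_d(F) / Ā(F)`:
the class of `g` is the flag whose `k`-th subspace is spanned by the last `k` columns of `g`.
It carries the quotient topology and the action of `GL_d(F)` by left translations. -/
abbrev FlagManifold (d : ℕ) (F : Type*) [Field F] : Type _ :=
  GL (Fin d) F ⧸ lowerTriangular d F

/-- The permutation matrix of `w`, with entries `1` at the places `(i, w i)`, as an element of
`GL_d(F)`. With this convention, for an upper triangular unipotent matrix `u`, one has
`u ∈ w U w⁻¹` if and only if `u i j = 0` whenever `i < j` and `w i > w j`. -/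
def permGL {d : ℕ} (F : Type*) [Field F] (w : Equiv.Perm (Fin d)) : GL (Fin d) F where
  val := w.permMatrix F
  inv := w⁻¹.permMatrix F
  val_inv := by rw [← Matrix.permMatrix_mul]; simp
  inv_val := by rw [← Matrix.permMatrix_mul]; simp

/-- The Bruhat cell `A(F) w Ā(F) / Ā(F)` in the flag manifold. -/
def bruhatCell {d : ℕ} (F : Type*) [Field F] (w : Equiv.Perm (Fin d)) :
    Set (FlagManifold d F) :=
  {b | ∃ a ∈ upperTriangular d F, b = QuotientGroup.mk (a * permGL F w)}

/-- For every real-valued `φ` there is a unique permutation `w` such that, for `i < j`,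
`w i > w j` if and only if `φ i ≥ φ j`. -/
theorem existsUnique_bruhatPerm {d : ℕ} (φ : Fin d → ℝ) :
    ∃! w : Equiv.Perm (Fin d), ∀ i j, i < j → (w j < w i ↔ φ j ≤ φ i) := by
  have key : ∀ w : Equiv.Perm (Fin d), (∀ i j, i < j → (w j < w i ↔ φ j ≤ φ i)) →
      ∀ i j, w j < w i ↔ φ j < φ i ∨ (φ j = φ i ∧ i < j) := by
    intro w hw i j
    rcases lt_trichotomy i j with h | rfl | h
    · rw [hw i j h, le_iff_lt_or_eq]
      simp [h]
    · simp
    · have h1 := hw j i h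
      have h2 : w j < w i ↔ ¬ w i < w j := by
        have : w i ≠ w j := fun e => h.ne' (w.injective e)
        rw [not_lt]
        exact ⟨le_of_lt, fun e => lt_of_le_of_ne e this.symm⟩
      rw [h2, h1, not_le]
      simp [h.not_gt]
  let f : Fin d → Lex (ℝ × (Fin d)ᵒᵈ) := fun i => toLex (φ i, OrderDual.toDual i)
  have hf : Function.Injective f := by
    intro i j h
    have := congrArg (fun x => (ofLex x).2) h
    simpa [f] using this
  have hs : StrictMono (f ∘ Tuple.sort f) :=
    (Tuple.monotone_sort f).strictMono_of_injective (hf.comp (Tuple.sort f).injective)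
  refine ⟨(Tuple.sort f)⁻¹, fun i j hij => ?_, fun w hw => ?_⟩
  · have h := hs.lt_iff_lt (a := (Tuple.sort f)⁻¹ j) (b := (Tuple.sort f)⁻¹ i)
    rw [Function.comp_apply, Function.comp_apply, ← Equiv.Perm.mul_apply,
      ← Equiv.Perm.mul_apply, mul_inv_cancel, Equiv.Perm.one_apply, Equiv.Perm.one_apply] at h
    rw [← h]
    simp only [f, Prod.Lex.toLex_lt_toLex, OrderDual.toDual_lt_toDual]
    rw [le_iff_lt_or_eq]
    simp [hij]
  · have hmono : StrictMono (f ∘ (w⁻¹ : Equiv.Perm (Fin d))) := by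
      intro a b hab
      have h := (key w hw (w⁻¹ b) (w⁻¹ a)).1 (by simpa using hab)
      simpa [f, Prod.Lex.toLex_lt_toLex] using h
    have hr : Set.range (f ∘ (w⁻¹ : Equiv.Perm (Fin d))) = Set.range (f ∘ Tuple.sort f) := by
      rw [EquivLike.range_comp f (w⁻¹), EquivLike.range_comp f (Tuple.sort f)]
    have h := (StrictMono.range_inj hmono hs).1 hr
    have h' : w⁻¹ = Tuple.sort f := Equiv.ext fun a => hf (congrFun h a)
    rw [← h', inv_inv]

/-- The unique permutation `w` such that, for `i < j`, `w i > w j` if and only if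
`φ i ≥ φ j`. -/
def bruhatPerm {d : ℕ} (φ : Fin d → ℝ) : Equiv.Perm (Fin d) :=
  (existsUnique_bruhatPerm φ).choose

/-! ### Random walks and boundaries -/

/-- The position `x_n = g_1 ⋯ g_n` of the random walk with increments `g_1 = g 0`,
`g_2 = g 1`, … -/
def walk {G : Type*} [Group G] (g : ℕ → G) : ℕ → G
  | 0 => 1
  | n + 1 => walk g n * g n

/-- The image `g ν` of a probability measure `ν` under the action of `g`. -/
def translateMeasure {G B : Type*} [Group G] [MulAction G B] [TopologicalSpace B]
    [ContinuousConstSMul G B] [MeasurableSpace B] [BorelSpace B]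
    (g : G) (ν : ProbabilityMeasure B) : ProbabilityMeasure B :=
  ν.map (f := fun b => g • b) (continuous_const_smul g).measurable.aemeasurable

/-- `(B, ν)` is a `μ`-boundary: `ν` is `μ`-stationary and, for almost every sequence
`(g_1, g_2, …)` of i.i.d. elements of law `μ`, the measures `g_1 ⋯ g_n ν` converge weakly to a
Dirac measure. -/
structure IsMuBoundary {G B : Type*} [Group G] [MeasurableSpace G] [MulAction G B]
    [TopologicalSpace B] [ContinuousConstSMul G B] [MeasurableSpace B] [BorelSpace B]
    (μ : Measure G) [IsProbabilityMeasure μ] (ν : ProbabilityMeasure B) : Prop where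
  stationary : ∀ s : Set B, MeasurableSet s →
    ∫⁻ g, (translateMeasure g ν : Measure B) s ∂μ = (ν : Measure B) s
  tendsto_dirac : ∀ᵐ g ∂(Measure.infinitePi fun _ : ℕ => μ), ∃ z : B,
    Tendsto (fun n => translateMeasure (walk g n) ν) atTop
      (𝓝 (⟨Measure.dirac z, inferInstance⟩ : ProbabilityMeasure B))

/-! ### Number fields -/

section NumberField

variable (d : ℕ) (K : Type*) [Field K] [NumberField K]

/-- The countable group `A(K)` carries the discrete σ-algebra. -/
instance instMeasurableSpaceUpperTriangular : MeasurableSpace (upperTriangular d K) := ⊤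

/-- The product `𝐁` of the flag manifolds over all completions of `K`, finite and infinite. -/
def FlagProduct : Type _ :=
  (∀ p : HeightOneSpectrum (𝓞 K), FlagManifold d (p.adicCompletion K)) ×
    (∀ v : InfinitePlace K, FlagManifold d v.Completion)

instance : TopologicalSpace (FlagProduct d K) :=
  inferInstanceAs (TopologicalSpace
    ((∀ p : HeightOneSpectrum (𝓞 K), FlagManifold d (p.adicCompletion K)) ×
      (∀ v : InfinitePlace K, FlagManifold d v.Completion)))

instance : MeasurableSpace (FlagProduct d K) := borel _

instance : BorelSpace (FlagProduct d K) := ⟨rfl⟩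

/-- The diagonal action of `A(K)` on the product of the flag manifolds, through the embeddings
of `K` in its completions. -/
instance : MulAction (upperTriangular d K) (FlagProduct d K) where
  smul a b :=
    (fun p => Matrix.GeneralLinearGroup.map (algebraMap K (p.adicCompletion K)) a.1 • b.1 p,
      fun v => Matrix.GeneralLinearGroup.map (algebraMap K v.Completion) a.1 • b.2 v)
  one_smul b := by
    refine Prod.ext (funext fun p => ?_) (funext fun v => ?_)
    · change Matrix.GeneralLinearGroup.map (algebraMap K (p.adicCompletion K)) 1 • b.1 p = _
      rw [map_one, one_smul]
    · change Matrix.GeneralLinearGroup.map (algebraMap K v.Completion) 1 • b.2 v = _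
      rw [map_one, one_smul]
  mul_smul a a' b := by
    refine Prod.ext (funext fun p => ?_) (funext fun v => ?_)
    · change Matrix.GeneralLinearGroup.map (algebraMap K (p.adicCompletion K)) (a.1 * a'.1) •
        b.1 p = _
      rw [map_mul, mul_smul]
      rfl
    · change Matrix.GeneralLinearGroup.map (algebraMap K v.Completion) (a.1 * a'.1) • b.2 v = _
      rw [map_mul, mul_smul]
      rfl

instance : ContinuousConstSMul (upperTriangular d K) (FlagProduct d K) where
  continuous_const_smul a := by
    refine Continuous.prodMk (continuous_pi fun p => ?_) (continuous_pi fun v => ?_)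
    · exact (continuous_const_smul
        (Matrix.GeneralLinearGroup.map (algebraMap K (p.adicCompletion K)) a.1)).comp
        ((continuous_apply p).comp continuous_fst)
    · exact (continuous_const_smul
        (Matrix.GeneralLinearGroup.map (algebraMap K v.Completion) a.1)).comp
        ((continuous_apply v).comp continuous_snd)

variable {d K}

/-- The normalized absolute value of `K` at a place: `|x|_p = N(p) ^ (-v_p(x))` at a prime ideal
`p`, and the usual absolute value (at a real place) or its square (at a complex place). -/
def placeAbs : HeightOneSpectrum (𝓞 K) ⊕ InfinitePlace K → K → ℝ
  | .inl p => fun x => NumberField.HeightOneSpectrum.adicAbv K p x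
  | .inr v => fun x => v x ^ v.mult

/-- `φ_v(i) = ∫ log |a_{i,i}|_v dμ(a)`, for a finite or infinite place `v`. -/
def phi (μ : Measure (upperTriangular d K)) (v : HeightOneSpectrum (𝓞 K) ⊕ InfinitePlace K)
    (i : Fin d) : ℝ :=
  ∫ a : upperTriangular d K, Real.log (placeAbs v ((a : GL (Fin d) K) i i)) ∂μ

/-- The cell `C_p(μ)` at a prime ideal `p`. -/
def finiteCell (μ : Measure (upperTriangular d K)) (p : HeightOneSpectrum (𝓞 K)) :
    Set (FlagManifold d (p.adicCompletion K)) :=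
  bruhatCell (p.adicCompletion K) (bruhatPerm (phi μ (.inl p)))

/-- The cell `C_v(μ)` at an infinite place `v`. -/
def infiniteCell (μ : Measure (upperTriangular d K)) (v : InfinitePlace K) :
    Set (FlagManifold d v.Completion) :=
  bruhatCell v.Completion (bruhatPerm (phi μ (.inr v)))

end NumberField

end

/-! Fix a place and let `φ` be its vector of mean logarithms. An invertible upper triangular matrix
factors as `u * r`, where `u` is unitriangular and supported, off the diagonal, on the places `i <
j` with `φ i < φ j`, and `r` vanishes at those places. The defining property of `w` says exactly
that `w⁻¹ r w` is lower triangular, so `u` is a global coordinate on the Bruhat cell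
(`mk_mul_permGL`, `mk_unitriGL_injective`). In this coordinate, a triangular matrix `a` multiplies
the entry `(i, j)` by `a i i / a j j` and adds terms built from `a` and from entries closer to the
diagonal.

By the law of large numbers, the product of `k` successive ratios is about `exp (-(φ j - φ i) * k)`,
hence contracting precisely at the places where `u` has a free entry, while integrability of the
logarithms makes all the coefficients of the increments subexponential. Induction on `j - i`, with
the backward recursion `ExpDecay.of_recursion` at each step, shows that two backward orbits approach
each other exponentially fast (`backward_sub_decay`). Therefore `x_n b` converges to a point `Z g`
of the cell which is the same for all `b` in the cell (`exists_cell_limit`).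

There are countably many places, so almost surely this holds at all of them along the same
trajectory `g`, and the limits form a point `Z g` of the product of the cells. Its law is the
required measure: peeling off the first increment gives `Z g = g 0 • Z (shift g)`, which is
stationarity, and dominated convergence turns pointwise convergence on the cells into convergence of
`x_n ν` to the Dirac measure at `Z g` (`isMuBoundary_map_of_tendsto`). -/

noncomputable section

/-! ### Factorization of triangular matrices adapted to a weight -/

section Factorization

variable {d : ℕ} {F : Type*} [Field F] (φ : Fin d → ℝ)

/-- The upper unitriangular matrix whose coefficients above the diagonal are those of `y` at the
places `(i, j)` with `φ i < φ j`, and zero elsewhere. -/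
def unitri (y : Matrix (Fin d) (Fin d) F) : Matrix (Fin d) (Fin d) F :=
  fun i j => if i = j then 1 else if i < j ∧ φ i < φ j then y i j else 0

@[simp] lemma unitri_diag (y : Matrix (Fin d) (Fin d) F) (i : Fin d) : unitri φ y i i = 1 := by
  simp [unitri]

lemma unitri_of_lt (y : Matrix (Fin d) (Fin d) F) {i j : Fin d} (h : i < j) (h' : φ i < φ j) :
    unitri φ y i j = y i j := by
  simp [unitri, h.ne, h, h']

lemma unitri_of_not_lt (y : Matrix (Fin d) (Fin d) F) {i j : Fin d} (h : i < j)
    (h' : ¬ φ i < φ j) : unitri φ y i j = 0 := by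
  simp [unitri, h.ne, h']

lemma unitri_of_gt (y : Matrix (Fin d) (Fin d) F) {i j : Fin d} (h : j < i) :
    unitri φ y i j = 0 := by
  simp [unitri, h.ne', h.not_gt]

lemma unitri_unitri (y : Matrix (Fin d) (Fin d) F) : unitri φ (unitri φ y) = unitri φ y := by
  ext i j
  simp only [unitri]
  split_ifs <;> rfl

lemma det_unitri (y : Matrix (Fin d) (Fin d) F) : (unitri φ y).det = 1 := by
  rw [Matrix.det_of_isUpperTriangular (M := unitri φ y) (fun i j h => unitri_of_gt φ y h)]
  simp

/-- `unitri φ y` as an element of `GL_d(F)`. -/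
def unitriGL (y : Matrix (Fin d) (Fin d) F) : GL (Fin d) F where
  val := unitri φ y
  inv := (unitri φ y).adjugate
  val_inv := by rw [Matrix.mul_adjugate, det_unitri, one_smul]
  inv_val := by rw [Matrix.adjugate_mul, det_unitri, one_smul]

@[simp] lemma coe_unitriGL (y : Matrix (Fin d) (Fin d) F) :
    (unitriGL φ y : Matrix (Fin d) (Fin d) F) = unitri φ y := rfl

lemma unitriGL_mem (y : Matrix (Fin d) (Fin d) F) : unitriGL φ y ∈ upperTriangular d F :=
  fun _ _ h => unitri_of_gt φ y h

/-- The coefficients obtained when a triangular matrix `M` is factored as the product of a matrix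
`unitri φ y` and of a triangular matrix vanishing at the places `i < j` with `φ i < φ j`. -/
def cellCoeff (M : Matrix (Fin d) (Fin d) F) (i j : Fin d) : F :=
  -- The equation `M = u * r` at `(i, j)`: one of `r i j` and `u i j * M j j` vanishes by the
  -- support conditions, and this value is the other one. The summands are `u i k * r k j`, already
  -- known since both gaps are smaller.
  M i j - ∑ k : {k // k ∈ Finset.Ioo i j},
    (if φ i < φ k then cellCoeff M i k / M k k else 0) *
      (if φ k < φ j then 0 else cellCoeff M k j)
termination_by j.1 - i.1
decreasing_by
  all_goals
    have := Finset.mem_Ioo.1 k.2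
    simp only [Fin.lt_def] at this
    omega

/-- The factor `u` in the factorization `M = u * r` of an invertible triangular matrix. -/
def unipPart (M : Matrix (Fin d) (Fin d) F) : Matrix (Fin d) (Fin d) F :=
  unitri φ (Matrix.of fun i j => cellCoeff φ M i j / M j j)

@[simp] lemma unipPart_diag (M : Matrix (Fin d) (Fin d) F) (i : Fin d) : unipPart φ M i i = 1 :=
  unitri_diag φ _ i

lemma unipPart_of_lt (M : Matrix (Fin d) (Fin d) F) {i j : Fin d} (h : i < j) (h' : φ i < φ j) :
    unipPart φ M i j = cellCoeff φ M i j / M j j :=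
  unitri_of_lt φ _ h h'

lemma unipPart_of_not_lt (M : Matrix (Fin d) (Fin d) F) {i j : Fin d} (h : i < j)
    (h' : ¬ φ i < φ j) : unipPart φ M i j = 0 :=
  unitri_of_not_lt φ _ h h'

lemma unipPart_of_gt (M : Matrix (Fin d) (Fin d) F) {i j : Fin d} (h : j < i) :
    unipPart φ M i j = 0 :=
  unitri_of_gt φ _ h

/-- The factor `r` in the factorization `M = u * r` of an invertible triangular matrix. -/
def restPart (M : Matrix (Fin d) (Fin d) F) : Matrix (Fin d) (Fin d) F :=
  fun i j => if i = j then M i i else if i < j ∧ ¬ φ i < φ j then cellCoeff φ M i j else 0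

@[simp] lemma restPart_diag (M : Matrix (Fin d) (Fin d) F) (i : Fin d) :
    restPart φ M i i = M i i := by
  simp [restPart]

lemma restPart_of_lt (M : Matrix (Fin d) (Fin d) F) {i j : Fin d} (h : i < j) (h' : φ i < φ j) :
    restPart φ M i j = 0 := by
  simp [restPart, h.ne, h']

lemma restPart_of_gt (M : Matrix (Fin d) (Fin d) F) {i j : Fin d} (h : j < i) :
    restPart φ M i j = 0 := by
  simp [restPart, h.ne', h.not_gt]

lemma mul_apply_of_lt {A B : Matrix (Fin d) (Fin d) F} (hA : ∀ i j, j < i → A i j = 0)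
    (hB : ∀ i j, j < i → B i j = 0) {i j : Fin d} (h : i < j) :
    (A * B) i j = A i i * B i j + ∑ k ∈ Finset.Ioo i j, A i k * B k j + A i j * B j j := by
  rw [Matrix.mul_apply, ← Finset.sum_subset (Finset.subset_univ (Finset.Icc i j)),
    ← Finset.Ioc_insert_left h.le, Finset.sum_insert (by simp), ← Finset.Ioo_insert_right h,
    Finset.sum_insert (by simp)]
  · ring
  · intro k _ hk
    rw [Finset.mem_Icc, not_and_or, not_le, not_le] at hk
    rcases hk with hk | hk
    · rw [hA _ _ hk, zero_mul]
    · rw [hB _ _ hk, mul_zero]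

lemma mul_apply_diag {A B : Matrix (Fin d) (Fin d) F} (hA : ∀ i j, j < i → A i j = 0)
    (hB : ∀ i j, j < i → B i j = 0) (i : Fin d) : (A * B) i i = A i i * B i i := by
  rw [Matrix.mul_apply, Finset.sum_eq_single i]
  · intro k _ hk
    rcases hk.lt_or_gt with hk | hk
    · rw [hA _ _ hk, zero_mul]
    · rw [hB _ _ hk, mul_zero]
  · simp

lemma mul_apply_of_gt {A B : Matrix (Fin d) (Fin d) F} (hA : ∀ i j, j < i → A i j = 0)
    (hB : ∀ i j, j < i → B i j = 0) {i j : Fin d} (h : j < i) : (A * B) i j = 0 :=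
  Matrix.BlockTriangular.mul (b := (id : Fin d → Fin d)) (M := A) (N := B)
    (fun i j h => hA i j h) (fun i j h => hB i j h) h

lemma unipPart_mul_restPart {M : Matrix (Fin d) (Fin d) F} (hM : ∀ i j, j < i → M i j = 0)
    (hM' : ∀ i, M i i ≠ 0) : unipPart φ M * restPart φ M = M := by
  have hU : ∀ i j, j < i → unipPart φ M i j = 0 := fun i j h => unipPart_of_gt φ M h
  have hR : ∀ i j, j < i → restPart φ M i j = 0 := fun i j h => restPart_of_gt φ M h
  ext i j
  rcases lt_trichotomy i j with h | rfl | h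
  · have key : cellCoeff φ M i j = M i j -
        ∑ k ∈ Finset.Ioo i j, unipPart φ M i k * restPart φ M k j := by
      rw [cellCoeff, ← Finset.sum_coe_sort (Finset.Ioo i j)]
      congr 1
      refine Finset.sum_congr rfl fun k _ => ?_
      obtain ⟨h1, h2⟩ := Finset.mem_Ioo.1 k.2
      simp only [unipPart, unitri, restPart, Matrix.of_apply, h1.ne, h2.ne, h1, h2, if_false,
        true_and]
      split_ifs <;> simp_all
    rw [mul_apply_of_lt hU hR h]
    by_cases h' : φ i < φ j
    · rw [restPart_of_lt φ M h h', unipPart_of_lt φ M h h', restPart_diag,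
        div_mul_cancel₀ _ (hM' j), key]
      ring
    · rw [unipPart_of_not_lt φ M h h', restPart, if_neg h.ne,
        if_pos ⟨h, h'⟩, key, unipPart_diag]
      ring
  · rw [mul_apply_diag hU hR, unipPart_diag, restPart_diag, one_mul]
  · rw [mul_apply_of_gt hU hR h, hM i j h]

lemma unitri_unipPart (M : Matrix (Fin d) (Fin d) F) : unitri φ (unipPart φ M) = unipPart φ M :=
  unitri_unitri φ _

end Factorization

/-! ### Coordinates on the Bruhat cell -/

section Cell

variable {d : ℕ} {F : Type*} [Field F] {φ : Fin d → ℝ} {w : Equiv.Perm (Fin d)}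

lemma diag_ne_zero_of_mem {g : GL (Fin d) F} (hg : g ∈ upperTriangular d F) (i : Fin d) :
    (g : Matrix (Fin d) (Fin d) F) i i ≠ 0 := by
  have h : (g : Matrix (Fin d) (Fin d) F).det ≠ 0 := by
    simpa using (Matrix.GeneralLinearGroup.det g).ne_zero
  rw [Matrix.det_of_isUpperTriangular (fun i j h => hg i j h)] at h
  exact Finset.prod_ne_zero_iff.1 h i (Finset.mem_univ i)

lemma permGL_conj_apply (w : Equiv.Perm (Fin d)) (r : GL (Fin d) F) (i j : Fin d) :
    (((permGL F w)⁻¹ * r * permGL F w : GL (Fin d) F) : Matrix (Fin d) (Fin d) F) i j =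
      (r : Matrix (Fin d) (Fin d) F) (w⁻¹ i) (w⁻¹ j) := by
  change ((w⁻¹).permMatrix F * r.1 * w.permMatrix F) i j = _
  rw [Equiv.Perm.permMatrix, Equiv.Perm.permMatrix, PEquiv.toMatrix_toPEquiv_mul,
    PEquiv.mul_toMatrix_toPEquiv]
  simp [Matrix.submatrix_apply]

/-- The class of `g w` only depends on the first factor of the factorization of `g`. -/
lemma mk_mul_permGL (hw : ∀ i j, i < j → (w j < w i ↔ φ j ≤ φ i)) {g : GL (Fin d) F}
    (hg : g ∈ upperTriangular d F) :
    (QuotientGroup.mk (g * permGL F w) : FlagManifold d F) =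
      QuotientGroup.mk (unitriGL φ (unipPart φ (g : Matrix (Fin d) (Fin d) F)) * permGL F w) := by
  set u := unitriGL φ (unipPart φ (g : Matrix (Fin d) (Fin d) F)) with hu
  have hr : ((u⁻¹ * g : GL (Fin d) F) : Matrix (Fin d) (Fin d) F) =
      restPart φ (g : Matrix (Fin d) (Fin d) F) := by
    have h : (u : Matrix (Fin d) (Fin d) F) * restPart φ (g : Matrix (Fin d) (Fin d) F) = g := by
      rw [hu, coe_unitriGL, unitri_unipPart]
      exact unipPart_mul_restPart φ hg (diag_ne_zero_of_mem hg)
    rw [Units.val_mul]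
    nth_rewrite 1 [← h]
    rw [← mul_assoc, ← Units.val_mul, inv_mul_cancel, Units.val_one, one_mul]
  symm
  rw [QuotientGroup.eq]
  intro i j hij
  have e : (u * permGL F w)⁻¹ * (g * permGL F w) =
      (permGL F w)⁻¹ * (u⁻¹ * g) * permGL F w := by group
  rw [e, permGL_conj_apply, hr]
  rcases lt_trichotomy (w⁻¹ i) (w⁻¹ j) with h | h | h
  -- The property of `w`, applied to `w⁻¹ i < w⁻¹ j`, whose images under `w` are in increasing
  -- order, forces `φ` to increase strictly between these indices.
  · refine restPart_of_lt φ _ h ?_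
    by_contra h'
    have := (hw _ _ h).2 (not_lt.1 h')
    exact absurd (by simpa using this) hij.not_gt
  · exact absurd (w⁻¹.injective h) hij.ne
  · exact restPart_of_gt φ _ h

/-- Uniqueness of the factorization: the quotient `r` of the two matrices is upper triangular and
becomes lower triangular after conjugation by `w`, so it vanishes at the places `i < j` with `φ i <
φ j`. At the other places above the diagonal both `unitri` matrices vanish, and comparing entries by
increasing gap gives `r = 1`. -/
lemma mk_unitriGL_injective (hw : ∀ i j, i < j → (w j < w i ↔ φ j ≤ φ i))
    {y z : Matrix (Fin d) (Fin d) F}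
    (h : (QuotientGroup.mk (unitriGL φ y * permGL F w) : FlagManifold d F) =
      QuotientGroup.mk (unitriGL φ z * permGL F w)) : unitri φ y = unitri φ z := by
  rw [QuotientGroup.eq] at h
  set r := (unitriGL φ y)⁻¹ * unitriGL φ z with hr
  have hru : r ∈ upperTriangular d F :=
    mul_mem (inv_mem (unitriGL_mem φ y)) (unitriGL_mem φ z)
  have e : (unitriGL φ y * permGL F w)⁻¹ * (unitriGL φ z * permGL F w) =
      (permGL F w)⁻¹ * r * permGL F w := by rw [hr]; group
  rw [e] at h
  have hr0 : ∀ i j, i < j → φ i < φ j → (r : Matrix (Fin d) (Fin d) F) i j = 0 := by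
    intro i j hij hφ
    have h1 : w i < w j := by
      have h2 := (hw i j hij).not.2 (not_le.2 hφ)
      exact lt_of_le_of_ne (not_lt.1 h2) fun e => hij.ne (w.injective e)
    have := h _ _ h1
    rw [permGL_conj_apply] at this
    simpa using this
  have hmul : unitri φ y * (r : Matrix (Fin d) (Fin d) F) = unitri φ z := by
    rw [← coe_unitriGL, ← Units.val_mul, hr, mul_inv_cancel_left, coe_unitriGL]
  have hY : ∀ i j, j < i → unitri φ y i j = 0 := fun i j h => unitri_of_gt φ y h
  have hdiag : ∀ i, (r : Matrix (Fin d) (Fin d) F) i i = 1 := by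
    intro i
    have := congrFun (congrFun hmul i) i
    rwa [mul_apply_diag hY hru, unitri_diag, unitri_diag, one_mul] at this
  have hoff : ∀ n : ℕ, ∀ i j : Fin d, i < j → j.1 - i.1 ≤ n →
      (r : Matrix (Fin d) (Fin d) F) i j = 0 := by
    intro n
    induction n with
    | zero => intro i j hij hn; rw [Fin.lt_def] at hij; omega
    | succ n ih =>
      intro i j hij hn
      by_cases hφ : φ i < φ j
      · exact hr0 i j hij hφ
      have := congrFun (congrFun hmul i) j
      rw [mul_apply_of_lt hY hru hij, Finset.sum_eq_zero, unitri_diag,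
        unitri_of_not_lt φ y hij hφ, unitri_of_not_lt φ z hij hφ] at this
      · simpa using this
      · intro k hk
        obtain ⟨h1, h2⟩ := Finset.mem_Ioo.1 hk
        rw [ih k j h2 (by rw [Fin.lt_def] at h1 h2; omega), mul_zero]
  have hone : (r : Matrix (Fin d) (Fin d) F) = 1 := by
    ext i j
    rcases lt_trichotomy i j with h | rfl | h
    · rw [hoff _ i j h le_rfl, Matrix.one_apply_ne h.ne]
    · rw [hdiag, Matrix.one_apply_eq]
    · rw [hru i j h, Matrix.one_apply_ne h.ne']
  rw [← hmul, hone, mul_one]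

lemma bruhatCell_eq_range (hw : ∀ i j, i < j → (w j < w i ↔ φ j ≤ φ i)) :
    bruhatCell F w = Set.range fun y : Matrix (Fin d) (Fin d) F =>
      (QuotientGroup.mk (unitriGL φ y * permGL F w) : FlagManifold d F) := by
  ext b
  constructor
  · rintro ⟨a, ha, rfl⟩
    exact ⟨_, (mk_mul_permGL hw ha).symm⟩
  · rintro ⟨y, rfl⟩
    exact ⟨_, unitriGL_mem φ y, rfl⟩

end Cell

/-! ### Exponential growth of doubly indexed families -/

section Growth

variable {F : Type*} [NormedField F]

/-- The family `f k m` decays at rate `c` in `k`, up to a subexponential factor in `k + m`. -/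
def ExpDecay (c : ℝ) (f : ℕ → ℕ → F) : Prop :=
  ∀ ε > 0, ∃ C, ∀ k m : ℕ, ‖f k m‖ ≤ C * Real.exp (-(c * k) + ε * (k + m))

/-- The sequence `a` and its inverse grow at a subexponential rate after multiplication by
`exp (c m)`. -/
def HasExpRate (c : ℝ) (A : ℕ → ℝ) : Prop :=
  ∀ ε > 0, ∃ C, ∀ m : ℕ, A m ≤ C * Real.exp (-(c * m) + ε * m) ∧
    (A m)⁻¹ ≤ C * Real.exp (c * m + ε * m)

namespace ExpDecay

variable {c : ℝ} {f g : ℕ → ℕ → F}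

lemma exists_pos (hf : ExpDecay c f) {ε : ℝ} (hε : 0 < ε) :
    ∃ C, 0 < C ∧ ∀ k m : ℕ, ‖f k m‖ ≤ C * Real.exp (-(c * k) + ε * (k + m)) := by
  obtain ⟨C, hC⟩ := hf ε hε
  refine ⟨max C 1, by positivity, fun k m => (hC k m).trans ?_⟩
  gcongr
  exact le_max_left _ _

lemma zero : ExpDecay c (fun _ _ => (0 : F)) := fun ε _ => ⟨0, fun k m => by simp⟩

lemma add (hf : ExpDecay c f) (hg : ExpDecay c g) : ExpDecay c fun k m => f k m + g k m := by
  intro ε hε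
  obtain ⟨C, hC⟩ := hf ε hε
  obtain ⟨D, hD⟩ := hg ε hε
  refine ⟨C + D, fun k m => (norm_add_le _ _).trans ?_⟩
  rw [add_mul]
  exact add_le_add (hC k m) (hD k m)

lemma neg (hf : ExpDecay c f) : ExpDecay c fun k m => -f k m := by
  simpa only [ExpDecay, norm_neg] using hf

lemma sub (hf : ExpDecay c f) (hg : ExpDecay c g) : ExpDecay c fun k m => f k m - g k m := by
  simpa only [sub_eq_add_neg] using hf.add hg.neg

lemma sum {ι : Type*} (s : Finset ι) {f : ι → ℕ → ℕ → F} (hf : ∀ i ∈ s, ExpDecay c (f i)) :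
    ExpDecay c fun k m => ∑ i ∈ s, f i k m := by
  classical
  induction s using Finset.induction_on with
  | empty => simpa using zero
  | insert i s hi ih =>
    simp only [Finset.sum_insert hi]
    exact (hf i (by simp)).add (ih fun j hj => hf j (by simp [hj]))

/-- Half of `ε` goes to each factor. Families of rate `0` thus form a ring and those of rate `c` a
module over it, so polynomial expressions in the entries can be estimated term by term. -/
lemma mul (hf : ExpDecay c f) (hg : ExpDecay 0 g) : ExpDecay c fun k m => f k m * g k m := by
  intro ε hε
  obtain ⟨C, hC0, hC⟩ := hf.exists_pos (half_pos hε)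
  obtain ⟨D, hD⟩ := hg _ (half_pos hε)
  refine ⟨C * D, fun k m => ?_⟩
  rw [norm_mul]
  refine (mul_le_mul (hC k m) (hD k m) (norm_nonneg _) (by positivity)).trans_eq ?_
  rw [mul_mul_mul_comm, ← Real.exp_add]
  ring_nf

lemma mul' (hf : ExpDecay 0 f) (hg : ExpDecay c g) : ExpDecay c fun k m => f k m * g k m := by
  simpa only [mul_comm] using hg.mul hf

lemma shift_left (hf : ExpDecay c f) : ExpDecay c fun k m => f (k + 1) m := by
  intro ε hε
  obtain ⟨C, hC⟩ := hf ε hε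
  refine ⟨C * Real.exp (-c + ε), fun k m => (hC (k + 1) m).trans_eq ?_⟩
  rw [mul_assoc, ← Real.exp_add]
  push_cast
  ring_nf

lemma shift_right (hf : ExpDecay c f) : ExpDecay c fun k m => f k (m + 1) := by
  intro ε hε
  obtain ⟨C, hC⟩ := hf ε hε
  refine ⟨C * Real.exp ε, fun k m => (hC k (m + 1)).trans_eq ?_⟩
  rw [mul_assoc, ← Real.exp_add]
  push_cast
  ring_nf

/-- A sequence of subexponential growth, seen as a family constant in the first index. -/
lemma of_seq {a : ℕ → F} (ha : ∀ ε > 0, ∃ C, ∀ m : ℕ, ‖a m‖ ≤ C * Real.exp (ε * m)) :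
    ExpDecay 0 fun _ m => a m := by
  intro ε hε
  obtain ⟨C, hC⟩ := ha ε hε
  have hC0 : 0 ≤ C := by simpa using (norm_nonneg _).trans (hC 0)
  refine ⟨C, fun k m => (hC m).trans ?_⟩
  gcongr
  have : 0 ≤ ε * k := by positivity
  nlinarith

lemma const (x : F) : ExpDecay 0 fun _ _ => x := by
  refine of_seq fun ε hε => ⟨‖x‖, fun m => ?_⟩
  have : 1 ≤ Real.exp (ε * m) := Real.one_le_exp (by positivity)
  nlinarith [norm_nonneg x]

/-- Backward affine recursion: if `f (k + 1) m = α m * f k (m + 1) + h k m`, where the products of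
the `α m` decay at rate `c`, then the decay of `h` passes to `f`. -/
lemma of_recursion {h : ℕ → ℕ → F} {α : ℕ → F} {A : ℕ → ℝ}
    (hA : ∀ m, 0 < A m) (hAα : ∀ m, A m * ‖α m‖ ≤ A (m + 1)) (hAc : HasExpRate c A)
    (hf0 : ∀ ε > 0, ∃ C, ∀ m : ℕ, ‖f 0 m‖ ≤ C * Real.exp (ε * m))
    (hh : ExpDecay c h) (hf : ∀ k m, f (k + 1) m = α m * f k (m + 1) + h k m) :
    ExpDecay c f := by
  intro δ hδ
  -- The final bound loses `3 * ε * (k + m)`: twice `ε` in the weighted estimate `main`, and once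
  -- more from inverting `A` (in `m`) and from absorbing the factor `k + 1` (in `k`).
  set ε := δ / 4 with hε_def
  have hε : 0 < ε := by positivity
  obtain ⟨C₁, hC₁, hh⟩ := hh.exists_pos hε
  obtain ⟨C₂, hf0⟩ := hf0 ε hε
  obtain ⟨C₃, hAc⟩ := hAc ε hε
  have hC₂ : 0 ≤ C₂ := by simpa using (norm_nonneg _).trans (hf0 0)
  have hC₃ : 0 ≤ C₃ := by simpa using (hA 0).le.trans (hAc 0).1
  set K := C₃ * C₂ + C₃ * C₁ * Real.exp c with hK
  have hK0 : 0 ≤ K := by positivity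
  -- The weight `A m` turns multiplication by `α m` into passage to `A (m + 1)`. The exponential
  -- depends on `k + m` only, which the recursion from `(k + 1, m)` to `(k, m + 1)` preserves up to
  -- the source term; the factor `k + 1` counts the initial term and the `k` source terms.
  have main : ∀ k m : ℕ,
      A m * ‖f k m‖ ≤ (k + 1) * K * Real.exp ((-c + 2 * ε) * (k + m)) := by
    intro k
    induction k with
    | zero =>
      intro m
      calc A m * ‖f 0 m‖ ≤ (C₃ * Real.exp (-(c * m) + ε * m)) * (C₂ * Real.exp (ε * m)) :=
            mul_le_mul (hAc m).1 (hf0 m) (norm_nonneg _) (by positivity)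
        _ = C₃ * C₂ * Real.exp ((-c + 2 * ε) * m) := by
            rw [mul_mul_mul_comm, ← Real.exp_add]; ring_nf
        _ ≤ K * Real.exp ((-c + 2 * ε) * m) := by
            gcongr
            exact le_add_of_nonneg_right (by positivity)
        _ = _ := by simp
    | succ k ih =>
      intro m
      have h2 : A m * ‖h k m‖ ≤ K * Real.exp ((-c + 2 * ε) * (k + m + 1)) := by
        calc A m * ‖h k m‖
            ≤ (C₃ * Real.exp (-(c * m) + ε * m)) * (C₁ * Real.exp (-(c * k) + ε * (k + m))) :=
              mul_le_mul (hAc m).1 (hh k m) (norm_nonneg _) (by positivity)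
          _ = C₃ * C₁ * Real.exp (-(c * m) + ε * m + (-(c * k) + ε * (k + m))) := by
              rw [mul_mul_mul_comm, ← Real.exp_add]
          -- The source term sits at level `k + m`, one below the target exponent; this is the
          -- origin of `Real.exp c` in `K`.
          _ ≤ C₃ * C₁ * Real.exp (c + (-c + 2 * ε) * (k + m + 1)) := by
              refine mul_le_mul_of_nonneg_left (Real.exp_le_exp.2 ?_) (by positivity)
              have : 0 ≤ ε * k := by positivity
              nlinarith
          _ = C₃ * C₁ * Real.exp c * Real.exp ((-c + 2 * ε) * (k + m + 1)) := by
              rw [Real.exp_add]; ring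
          _ ≤ _ := by
              gcongr
              exact le_add_of_nonneg_left (by positivity)
      calc A m * ‖f (k + 1) m‖
          ≤ A m * (‖α m‖ * ‖f k (m + 1)‖ + ‖h k m‖) := by
            gcongr
            · exact (hA m).le
            · rw [hf, ← norm_mul]
              exact norm_add_le _ _
        _ = A m * ‖α m‖ * ‖f k (m + 1)‖ + A m * ‖h k m‖ := by ring
        _ ≤ A (m + 1) * ‖f k (m + 1)‖ + A m * ‖h k m‖ := by
            gcongr
            exact hAα m
        _ ≤ (k + 1) * K * Real.exp ((-c + 2 * ε) * (k + (m + 1 : ℕ))) +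
              K * Real.exp ((-c + 2 * ε) * (k + m + 1)) := add_le_add (ih (m + 1)) h2
        _ = _ := by push_cast; ring_nf
  refine ⟨C₃ * K * max 1 ε⁻¹, fun k m => ?_⟩
  have hk : ((k : ℝ) + 1) ≤ max 1 ε⁻¹ * Real.exp (ε * k) := by
    have h1 : ε * k + 1 ≤ Real.exp (ε * k) := Real.add_one_le_exp _
    have h2 : (k : ℝ) = ε⁻¹ * (ε * k) := by field_simp
    calc (k : ℝ) + 1 ≤ max 1 ε⁻¹ * (ε * k) + max 1 ε⁻¹ * 1 := by
          refine add_le_add ?_ ?_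
          · conv_lhs => rw [h2]
            gcongr
            exact le_max_right _ _
          · rw [mul_one]; exact le_max_left _ _
      _ = max 1 ε⁻¹ * (ε * k + 1) := by ring
      _ ≤ _ := by gcongr
  calc ‖f k m‖ = (A m)⁻¹ * (A m * ‖f k m‖) := by
        rw [inv_mul_cancel_left₀ (hA m).ne']
    _ ≤ (C₃ * Real.exp (c * m + ε * m)) *
          ((k + 1) * K * Real.exp ((-c + 2 * ε) * (k + m))) :=
        mul_le_mul (hAc m).2 (main k m) (mul_nonneg (hA m).le (norm_nonneg _)) (by positivity)
    _ ≤ (C₃ * Real.exp (c * m + ε * m)) *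
          (max 1 ε⁻¹ * Real.exp (ε * k) * K * Real.exp ((-c + 2 * ε) * (k + m))) := by gcongr
    _ = C₃ * K * max 1 ε⁻¹ *
          Real.exp ((c * m + ε * m) + ε * k + (-c + 2 * ε) * (k + m)) := by
        rw [Real.exp_add (c * m + ε * m + ε * k), Real.exp_add (c * m + ε * m)]; ring
    _ ≤ _ := by
        refine mul_le_mul_of_nonneg_left (Real.exp_le_exp.2 ?_) (by positivity)
        have h1 : 0 ≤ ε * k := by positivity
        have h2 : 0 ≤ ε * m := by positivity
        have h3 : δ = 4 * ε := by rw [hε_def]; ring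
        rw [h3]
        nlinarith

end ExpDecay

end Growth

/-! ### Contraction of the Bruhat cell by products of triangular matrices -/

section Contraction

variable {d : ℕ} {F : Type*}

/-- The backward iterates `T m (T (m + 1) (⋯ (T (m + k - 1) (p (m + k)))))`. -/
def backward {X : Type*} (T : ℕ → X → X) (p : ℕ → X) : ℕ → ℕ → X
  | 0, m => p m
  | k + 1, m => T m (backward T p k (m + 1))

/-- Consecutive iterates become iterates of the same length with different end data, so that a
contraction estimate yields a Cauchy sequence. -/
lemma backward_succ_eq {X : Type*} (T : ℕ → X → X) (p : ℕ → X) (k m : ℕ) :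
    backward T p (k + 1) m = backward T (fun n => T n (p (n + 1))) k m := by
  induction k generalizing m with
  | zero => rfl
  | succ k ih => rw [backward, ih, backward]

/-- The action of `a m` on the coordinates of the Bruhat cell. -/
def cellStep [Field F] (φ : Fin d → ℝ) (a : ℕ → Matrix (Fin d) (Fin d) F) (m : ℕ)
    (y : Matrix (Fin d) (Fin d) F) : Matrix (Fin d) (Fin d) F :=
  unipPart φ (a m * unitri φ y)

/-- A sequence of triangular matrices whose diagonal products have exponential rates given by `φ`
and whose coefficients have subexponential growth. The number `c` bounds the gaps of `φ`. -/
structure IsTempered [NormedField F] (φ : Fin d → ℝ) (c : ℝ)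
    (a : ℕ → Matrix (Fin d) (Fin d) F) : Prop where
  upper : ∀ m i j, j < i → a m i j = 0
  diag_ne_zero : ∀ m i, a m i i ≠ 0
  entry : ∀ i j, ExpDecay 0 fun _ m => a m i j
  inv_diag : ∀ i, ExpDecay 0 fun _ m => (a m i i)⁻¹
  -- `A` dominates the partial products of the ratios while behaving like `exp (-(c' * m))`. The
  -- value `c' = 0` serves for growth bounds and `c' = c` for contraction.
  rate : ∀ i j, i < j → φ i < φ j → ∀ c', 0 ≤ c' → c' ≤ c → ∃ A : ℕ → ℝ, (∀ m, 0 < A m) ∧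
    (∀ m, A m * ‖a m i i / a m j j‖ ≤ A (m + 1)) ∧ HasExpRate c' A

section Algebra

variable [Field F] {φ : Fin d → ℝ} {a : ℕ → Matrix (Fin d) (Fin d) F}

lemma unitri_cellStep (m : ℕ) (y : Matrix (Fin d) (Fin d) F) :
    unitri φ (cellStep φ a m y) = cellStep φ a m y :=
  unitri_unipPart φ _

lemma mul_unitri_upper {b : Matrix (Fin d) (Fin d) F} (hb : ∀ i j, j < i → b i j = 0)
    (y : Matrix (Fin d) (Fin d) F) : ∀ i j, j < i → (b * unitri φ y) i j = 0 :=
  fun _ _ h => mul_apply_of_gt hb (fun _ _ h => unitri_of_gt φ y h) h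

lemma mul_unitri_diag {b : Matrix (Fin d) (Fin d) F} (hb : ∀ i j, j < i → b i j = 0)
    (y : Matrix (Fin d) (Fin d) F) (i : Fin d) : (b * unitri φ y) i i = b i i := by
  rw [mul_apply_diag hb (fun _ _ h => unitri_of_gt φ y h), unitri_diag, mul_one]

/-- The coefficient form of the factorization `b * unitri φ y = u * r`. -/
lemma factor_apply {b : Matrix (Fin d) (Fin d) F} (hb : ∀ i j, j < i → b i j = 0)
    (hb' : ∀ i, b i i ≠ 0) {y z : Matrix (Fin d) (Fin d) F} (hz : unitri φ y = z)
    {i j : Fin d} (h : i < j) :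
    restPart φ (b * unitri φ y) i j + unipPart φ (b * unitri φ y) i j * b j j =
      b i i * z i j + (b i j + ∑ k ∈ Finset.Ioo i j, (b i k * z k j -
        unipPart φ (b * unitri φ y) i k * restPart φ (b * unitri φ y) k j)) := by
  subst hz
  have hM := mul_unitri_upper (φ := φ) hb y
  have hM' := mul_unitri_diag (φ := φ) hb y
  have := congrFun (congrFun (unipPart_mul_restPart φ hM fun i => by rw [hM']; exact hb' i) i) j
  rw [mul_apply_of_lt (fun _ _ h => unipPart_of_gt φ _ h) (fun _ _ h => restPart_of_gt φ _ h) h,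
    mul_apply_of_lt hb (fun _ _ h => unitri_of_gt φ y h) h, unipPart_diag, restPart_diag, hM',
    unitri_diag] at this
  rw [Finset.sum_sub_distrib]
  linear_combination this

end Algebra

variable [NormedField F] {φ : Fin d → ℝ} {a : ℕ → Matrix (Fin d) (Fin d) F} {c : ℝ}
  {p q : ℕ → Matrix (Fin d) (Fin d) F}

/-- The complementary factor at each step of the backward iteration. -/
def cellRest (φ : Fin d → ℝ) (a p : ℕ → Matrix (Fin d) (Fin d) F) (k m : ℕ) :
    Matrix (Fin d) (Fin d) F :=
  restPart φ (a m * unitri φ (backward (cellStep φ a) p k (m + 1)))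

lemma unitri_backward (hp : ∀ m, unitri φ (p m) = p m) (k m : ℕ) :
    unitri φ (backward (cellStep φ a) p k m) = backward (cellStep φ a) p k m := by
  cases k with
  | zero => exact hp m
  | succ k => exact unitri_cellStep m _

lemma backward_factor (ha : IsTempered φ c a) (hp : ∀ m, unitri φ (p m) = p m) (k m : ℕ)
    {i j : Fin d} (h : i < j) :
    cellRest φ a p k m i j + backward (cellStep φ a) p (k + 1) m i j * a m j j =
      a m i i * backward (cellStep φ a) p k (m + 1) i j + (a m i j +
        ∑ l ∈ Finset.Ioo i j, (a m i l * backward (cellStep φ a) p k (m + 1) l j -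
          backward (cellStep φ a) p (k + 1) m i l * cellRest φ a p k m l j)) :=
  factor_apply (φ := φ) (ha.upper m) (ha.diag_ne_zero m) (unitri_backward hp k (m + 1)) h

lemma backward_recursion (ha : IsTempered φ c a) (hp : ∀ m, unitri φ (p m) = p m) (k m : ℕ)
    {i j : Fin d} (h : i < j) (h' : φ i < φ j) :
    backward (cellStep φ a) p (k + 1) m i j =
      a m i i / a m j j * backward (cellStep φ a) p k (m + 1) i j + (a m j j)⁻¹ * (a m i j +
        ∑ l ∈ Finset.Ioo i j, (a m i l * backward (cellStep φ a) p k (m + 1) l j -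
          backward (cellStep φ a) p (k + 1) m i l * cellRest φ a p k m l j)) := by
  have h1 := backward_factor ha hp k m h
  rw [cellRest, restPart_of_lt φ _ h h', ← cellRest, zero_add] at h1
  have := ha.diag_ne_zero m j
  refine mul_right_cancel₀ this ?_
  rw [h1]
  field_simp

lemma cellRest_of_not_lt (ha : IsTempered φ c a) (hp : ∀ m, unitri φ (p m) = p m) (k m : ℕ)
    {i j : Fin d} (h : i < j) (h' : ¬ φ i < φ j) :
    cellRest φ a p k m i j = a m i j +
        ∑ l ∈ Finset.Ioo i j, (a m i l * backward (cellStep φ a) p k (m + 1) l j -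
          backward (cellStep φ a) p (k + 1) m i l * cellRest φ a p k m l j) := by
  have h1 := backward_factor ha hp k m h
  have hz : ∀ k m, backward (cellStep φ a) p k m i j = 0 := fun k m => by
    rw [← unitri_backward hp, unitri_of_not_lt φ _ h h']
  rw [hz, hz] at h1
  simpa using h1

lemma Fin.induction_on_gap {P : Fin d → Fin d → Prop}
    (h : ∀ i j, i < j → (∀ l ∈ Finset.Ioo i j, P i l ∧ P l j) → P i j) :
    ∀ i j, i < j → P i j := by
  have : ∀ n : ℕ, ∀ i j : Fin d, i < j → j.1 - i.1 ≤ n → P i j := by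
    intro n
    induction n with
    | zero => intro i j hij hn; rw [Fin.lt_def] at hij; omega
    | succ n ih =>
      intro i j hij hn
      refine h i j hij fun l hl => ?_
      obtain ⟨h1, h2⟩ := Finset.mem_Ioo.1 hl
      have h1' := h1
      have h2' := h2
      rw [Fin.lt_def] at h1' h2'
      exact ⟨ih i l h1 (by omega), ih l j h2 (by omega)⟩
  exact fun i j hij => this _ i j hij le_rfl

/-- The coordinates and the complementary factors are treated together, since the source term at
`(i, j)` contains products of both at smaller gaps. These bounds control the coefficients when two
orbits are subtracted. -/
lemma backward_growth_aux (ha : IsTempered φ c a) (hc : 0 ≤ c) (hp : ∀ m, unitri φ (p m) = p m)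
    (hp' : ∀ i j, ∀ ε > 0, ∃ C, ∀ m : ℕ, ‖p m i j‖ ≤ C * Real.exp (ε * m)) :
    ∀ i j, i < j → ExpDecay 0 (fun k m => backward (cellStep φ a) p k m i j) ∧
      ExpDecay 0 (fun k m => cellRest φ a p k m i j) := by
  refine Fin.induction_on_gap fun i j hij ih => ?_
  have hsum : ExpDecay 0 fun k m => a m i j +
      ∑ l ∈ Finset.Ioo i j, (a m i l * backward (cellStep φ a) p k (m + 1) l j -
        backward (cellStep φ a) p (k + 1) m i l * cellRest φ a p k m l j) :=
    (ha.entry i j).add <| ExpDecay.sum _ fun l hl =>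
      ((ha.entry i l).mul (ih l hl).2.1.shift_right).sub
        ((ih l hl).1.1.shift_left.mul (ih l hl).2.2)
  by_cases hφ : φ i < φ j
  · constructor
    · obtain ⟨A, hA, hAα, hAc⟩ := ha.rate i j hij hφ 0 le_rfl hc
      exact ExpDecay.of_recursion hA hAα hAc (hp' i j) ((ha.inv_diag j).mul hsum)
        fun k m => backward_recursion ha hp k m hij hφ
    · simpa only [cellRest, restPart_of_lt φ _ hij hφ] using ExpDecay.zero
  · constructor
    · have hz : ∀ k m, backward (cellStep φ a) p k m i j = 0 := fun k m => by
        rw [← unitri_backward hp, unitri_of_not_lt φ _ hij hφ]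
      simpa only [hz] using ExpDecay.zero
    · simpa only [cellRest_of_not_lt ha hp _ _ hij hφ] using hsum

lemma backward_growth (ha : IsTempered φ c a) (hc : 0 ≤ c) (hp : ∀ m, unitri φ (p m) = p m)
    (hp' : ∀ i j, ∀ ε > 0, ∃ C, ∀ m : ℕ, ‖p m i j‖ ≤ C * Real.exp (ε * m)) (i j : Fin d) :
    ExpDecay 0 (fun k m => backward (cellStep φ a) p k m i j) := by
  rcases lt_trichotomy i j with h | rfl | h
  · exact (backward_growth_aux ha hc hp hp' i j h).1
  · have hz : ∀ k m, backward (cellStep φ a) p k m i i = 1 := fun k m => by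
      rw [← unitri_backward hp, unitri_diag]
    simpa only [hz] using ExpDecay.const 1
  · have hz : ∀ k m, backward (cellStep φ a) p k m i j = 0 := fun k m => by
      rw [← unitri_backward hp, unitri_of_gt φ _ h]
    simpa only [hz] using ExpDecay.zero

/-- In the difference of the two recursions the term `a m i j` cancels, and each product is split as
`x y - x' y' = (x - x') y + x' (y - y')`: one factor decays at rate `c` by induction, the other has
rate `0` by `backward_growth_aux`. -/
lemma backward_sub_decay_aux (ha : IsTempered φ c a) (hc : 0 ≤ c)
    (hp : ∀ m, unitri φ (p m) = p m) (hq : ∀ m, unitri φ (q m) = q m)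
    (hp' : ∀ i j, ∀ ε > 0, ∃ C, ∀ m : ℕ, ‖p m i j‖ ≤ C * Real.exp (ε * m))
    (hq' : ∀ i j, ∀ ε > 0, ∃ C, ∀ m : ℕ, ‖q m i j‖ ≤ C * Real.exp (ε * m)) :
    ∀ i j, i < j → ExpDecay c (fun k m => backward (cellStep φ a) p k m i j -
        backward (cellStep φ a) q k m i j) ∧
      ExpDecay c (fun k m => cellRest φ a p k m i j - cellRest φ a q k m i j) := by
  have gp := backward_growth_aux ha hc hp hp'
  have gq := backward_growth_aux ha hc hq hq'
  refine Fin.induction_on_gap fun i j hij ih => ?_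
  set U := backward (cellStep φ a) p with hU
  set V := backward (cellStep φ a) q with hV
  have hsum : ExpDecay c fun k m => ∑ l ∈ Finset.Ioo i j,
      (a m i l * (U k (m + 1) l j - V k (m + 1) l j) -
        ((U (k + 1) m i l - V (k + 1) m i l) * cellRest φ a p k m l j +
          V (k + 1) m i l * (cellRest φ a p k m l j - cellRest φ a q k m l j))) := by
    refine ExpDecay.sum _ fun l hl => ?_
    obtain ⟨h1, h2⟩ := Finset.mem_Ioo.1 hl
    exact ((ha.entry i l).mul' (ih l hl).2.1.shift_right).sub
      (((ih l hl).1.1.shift_left.mul (gp l j h2).2).add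
        ((gq i l h1).1.shift_left.mul' (ih l hl).2.2))
  have hsum_eq : ∀ k m, (a m i j + ∑ l ∈ Finset.Ioo i j, (a m i l * U k (m + 1) l j -
        U (k + 1) m i l * cellRest φ a p k m l j)) -
      (a m i j + ∑ l ∈ Finset.Ioo i j, (a m i l * V k (m + 1) l j -
        V (k + 1) m i l * cellRest φ a q k m l j)) = ∑ l ∈ Finset.Ioo i j,
      (a m i l * (U k (m + 1) l j - V k (m + 1) l j) -
        ((U (k + 1) m i l - V (k + 1) m i l) * cellRest φ a p k m l j +
          V (k + 1) m i l * (cellRest φ a p k m l j - cellRest φ a q k m l j))) := by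
    intro k m
    rw [add_sub_add_left_eq_sub, ← Finset.sum_sub_distrib]
    exact Finset.sum_congr rfl fun l _ => by ring
  by_cases hφ : φ i < φ j
  · constructor
    · obtain ⟨A, hA, hAα, hAc⟩ := ha.rate i j hij hφ c hc le_rfl
      refine ExpDecay.of_recursion hA hAα hAc (fun ε hε => ?_) ((ha.inv_diag j).mul' hsum)
        fun k m => ?_
      · obtain ⟨C, hC⟩ := hp' i j ε hε
        obtain ⟨D, hD⟩ := hq' i j ε hε
        refine ⟨C + D, fun m => (norm_sub_le _ _).trans ?_⟩
        rw [add_mul]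
        exact add_le_add (hC m) (hD m)
      · rw [hU, hV, backward_recursion ha hp k m hij hφ, backward_recursion ha hq k m hij hφ,
          ← hU, ← hV, ← hsum_eq]
        ring
    · simpa only [cellRest, restPart_of_lt φ _ hij hφ, sub_zero] using ExpDecay.zero
  · constructor
    · have hz : ∀ k m, U k m i j = 0 := fun k m => by
        rw [hU, ← unitri_backward hp, unitri_of_not_lt φ _ hij hφ]
      have hz' : ∀ k m, V k m i j = 0 := fun k m => by
        rw [hV, ← unitri_backward hq, unitri_of_not_lt φ _ hij hφ]
      simpa only [hz, hz', sub_zero] using ExpDecay.zero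
    · simpa only [cellRest_of_not_lt ha hp _ _ hij hφ, cellRest_of_not_lt ha hq _ _ hij hφ,
        ← hU, ← hV, hsum_eq] using hsum

lemma backward_sub_decay (ha : IsTempered φ c a) (hc : 0 ≤ c)
    (hp : ∀ m, unitri φ (p m) = p m) (hq : ∀ m, unitri φ (q m) = q m)
    (hp' : ∀ i j, ∀ ε > 0, ∃ C, ∀ m : ℕ, ‖p m i j‖ ≤ C * Real.exp (ε * m))
    (hq' : ∀ i j, ∀ ε > 0, ∃ C, ∀ m : ℕ, ‖q m i j‖ ≤ C * Real.exp (ε * m)) (i j : Fin d) :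
    ExpDecay c (fun k m => backward (cellStep φ a) p k m i j -
        backward (cellStep φ a) q k m i j) := by
  rcases lt_or_ge i j with h | h
  · exact (backward_sub_decay_aux ha hc hp hq hp' hq' i j h).1
  · have hz : ∀ k m, backward (cellStep φ a) p k m i j = backward (cellStep φ a) q k m i j := by
      intro k m
      rw [← unitri_backward hp, ← unitri_backward hq]
      rcases h.eq_or_lt with rfl | h
      · simp
      · rw [unitri_of_gt φ _ h, unitri_of_gt φ _ h]
    simpa only [hz, sub_self] using ExpDecay.zero

lemma exists_bound_of_const (x : F) : ∀ ε > 0, ∃ C, ∀ m : ℕ, ‖x‖ ≤ C * Real.exp (ε * m) := by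
  intro ε hε
  refine ⟨‖x‖, fun m => ?_⟩
  have : 1 ≤ Real.exp (ε * m) := Real.one_le_exp (by positivity)
  nlinarith [norm_nonneg x]

/-- All the points of the Bruhat cell have the same limit under `a 0 * a 1 * ⋯ * a n`. -/
lemma exists_tendsto_backward [CompleteSpace F] (ha : IsTempered φ c a) (hc : 0 < c) :
    ∃ z : Matrix (Fin d) (Fin d) F, ∀ b, unitri φ b = b →
      Tendsto (fun k => backward (cellStep φ a) (fun _ => b) k 0) atTop (𝓝 z) := by
  have hexp : Tendsto (fun k : ℕ => Real.exp (-(c / 2) * k)) atTop (𝓝 0) :=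
    Real.tendsto_exp_atBot.comp
      (tendsto_natCast_atTop_atTop.const_mul_atTop_of_neg (by linarith))
  have hlim : ∀ (f : ℕ → ℕ → F), ExpDecay c f →
      ∃ C, ∀ k, ‖f k 0‖ ≤ C * Real.exp (-(c / 2) * k) := by
    intro f hf
    obtain ⟨C, hC⟩ := hf (c / 2) (by positivity)
    refine ⟨C, fun k => (hC k 0).trans_eq ?_⟩
    congr 2
    push_cast
    ring
  have hconst : ∀ b : Matrix (Fin d) (Fin d) F, ∀ i j, ∀ ε > 0, ∃ C, ∀ m : ℕ,
      ‖(fun _ : ℕ => b) m i j‖ ≤ C * Real.exp (ε * m) := fun b i j => exists_bound_of_const (b i j)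
  have hcauchy : ∀ i j, ∃ z : F,
      Tendsto (fun k => backward (cellStep φ a) (fun _ => (unitri φ 0 : Matrix _ _ F)) k 0 i j)
        atTop (𝓝 z) := by
    intro i j
    have h0 : ∀ m : ℕ, unitri φ ((fun _ => (unitri φ 0 : Matrix (Fin d) (Fin d) F)) m) =
      (fun _ => (unitri φ 0 : Matrix (Fin d) (Fin d) F)) m := fun m => unitri_unitri φ _
    -- The end data in `backward_succ_eq` depend on `n` and are only subexponential, which is why
    -- the estimates allow variable end data.
    have hstep : ∀ i j, ∀ ε > 0, ∃ C, ∀ m : ℕ,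
        ‖(fun n => cellStep φ a n (unitri φ 0)) m i j‖ ≤ C * Real.exp (ε * m) := by
      intro i j ε hε
      obtain ⟨C, hC⟩ := (backward_growth ha hc.le h0 (hconst _) i j).shift_left ε hε
      refine ⟨C, fun m => ?_⟩
      simpa [backward] using hC 0 m
    obtain ⟨C, hC⟩ := hlim _ (backward_sub_decay ha hc.le h0
      (fun m => unitri_cellStep m (unitri φ 0)) (hconst _) hstep i j)
    refine cauchySeq_tendsto_of_complete (cauchySeq_of_le_geometric (Real.exp (-(c / 2))) C
      (by rw [← Real.exp_zero]; exact Real.exp_lt_exp.2 (by linarith)) fun k => ?_)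
    rw [dist_eq_norm, backward_succ_eq, ← Real.exp_nat_mul, mul_comm (k : ℝ)]
    exact hC k
  choose z hz using hcauchy
  refine ⟨Matrix.of z, fun b hb => ?_⟩
  refine tendsto_pi_nhds.2 fun i => tendsto_pi_nhds.2 fun j => ?_
  obtain ⟨C, hC⟩ := hlim _ (backward_sub_decay ha hc.le (p := fun _ => b)
    (q := fun _ => unitri φ 0) (fun _ => hb) (fun _ => unitri_unitri φ _) (hconst _) (hconst _) i j)
  have h0 : Tendsto (fun k => backward (cellStep φ a) (fun _ => b) k 0 i j -
      backward (cellStep φ a) (fun _ => unitri φ 0) k 0 i j) atTop (𝓝 0) :=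
    squeeze_zero_norm hC (by simpa using hexp.const_mul C)
  simpa using h0.add (hz i j)

end Contraction

/-! ### Topology of the flag manifold of a normed field -/

section FlagTopology

variable {d : ℕ} {F : Type*} [NormedField F] {φ : Fin d → ℝ} {w : Equiv.Perm (Fin d)}

lemma continuous_unitri (φ : Fin d → ℝ) :
    Continuous (unitri φ : Matrix (Fin d) (Fin d) F → Matrix (Fin d) (Fin d) F) := by
  refine continuous_pi fun i => continuous_pi fun j => ?_
  simp only [unitri]
  split_ifs <;> fun_prop

lemma continuous_unitriGL (φ : Fin d → ℝ) :
    Continuous (unitriGL φ : Matrix (Fin d) (Fin d) F → GL (Fin d) F) := by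
  rw [Units.continuous_iff]
  exact ⟨continuous_unitri φ, (continuous_unitri φ).matrix_adjugate⟩

lemma continuous_mk_unitriGL (φ : Fin d → ℝ) (w : Equiv.Perm (Fin d)) :
    Continuous fun y : Matrix (Fin d) (Fin d) F =>
      (QuotientGroup.mk (unitriGL φ y * permGL F w) : FlagManifold d F) :=
  continuous_quotient_mk'.comp ((continuous_unitriGL φ).mul continuous_const)

lemma isClosed_lowerTriangular : IsClosed (lowerTriangular d F : Set (GL (Fin d) F)) := by
  have : (lowerTriangular d F : Set (GL (Fin d) F)) =
      ⋂ i : Fin d, ⋂ j : Fin d, ⋂ _ : i < j,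
        {g : GL (Fin d) F | (g : Matrix (Fin d) (Fin d) F) i j = 0} := by
    ext g
    simp [lowerTriangular]
  rw [this]
  refine isClosed_iInter fun i => isClosed_iInter fun j => isClosed_iInter fun _ => ?_
  exact isClosed_eq (Units.continuous_val.matrix_elem i j) continuous_const

lemma t2Space_flagManifold : T2Space (FlagManifold d F) := by
  rw [t2Space_iff_of_isOpenQuotientMap (π := (QuotientGroup.mk : GL (Fin d) F → FlagManifold d F))
    QuotientGroup.isOpenQuotientMap_mk]
  have : {q : GL (Fin d) F × GL (Fin d) F | (QuotientGroup.mk q.1 : FlagManifold d F) =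
      QuotientGroup.mk q.2} = (fun q => q.1⁻¹ * q.2) ⁻¹' (lowerTriangular d F : Set _) := by
    ext q
    simp [QuotientGroup.eq]
  rw [this]
  exact isClosed_lowerTriangular.preimage (by fun_prop)

lemma secondCountableTopology_flagManifold [SecondCountableTopology F] :
    SecondCountableTopology (FlagManifold d F) := by
  have : SecondCountableTopology (Matrix (Fin d) (Fin d) F) :=
    inferInstanceAs (SecondCountableTopology (Fin d → Fin d → F))
  have : SecondCountableTopology (Matrix (Fin d) (Fin d) F)ᵐᵒᵖ :=
    MulOpposite.opHomeomorph.symm.secondCountableTopology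
  have : SecondCountableTopology (GL (Fin d) F) :=
    Units.isEmbedding_embedProduct.secondCountableTopology
  infer_instance

/-- By Lusin–Souslin: the cell is the injective continuous image of a closed set of matrices in a
Polish space. -/
lemma measurableSet_bruhatCell [CompleteSpace F] [SecondCountableTopology F]
    (hw : ∀ i j, i < j → (w j < w i ↔ φ j ≤ φ i)) :
    MeasurableSet[borel (FlagManifold d F)] (bruhatCell F w) := by
  let _ : MeasurableSpace (FlagManifold d F) := borel _
  have : BorelSpace (FlagManifold d F) := ⟨rfl⟩
  have : T2Space (FlagManifold d F) := t2Space_flagManifold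
  let _ : MeasurableSpace (Matrix (Fin d) (Fin d) F) := borel _
  have : BorelSpace (Matrix (Fin d) (Fin d) F) := ⟨rfl⟩
  have : PolishSpace (Matrix (Fin d) (Fin d) F) :=
    inferInstanceAs (PolishSpace (Fin d → Fin d → F))
  have hs : MeasurableSet {y : Matrix (Fin d) (Fin d) F | unitri φ y = y} :=
    (isClosed_eq (continuous_unitri φ) continuous_id).measurableSet
  have himage : bruhatCell F w = (fun y : Matrix (Fin d) (Fin d) F =>
      (QuotientGroup.mk (unitriGL φ y * permGL F w) : FlagManifold d F)) ''
        {y | unitri φ y = y} := by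
    rw [bruhatCell_eq_range hw]
    refine Set.Subset.antisymm ?_ (Set.image_subset_range _ _)
    rintro _ ⟨y, rfl⟩
    refine ⟨unitri φ y, unitri_unitri φ y, ?_⟩
    have : unitriGL φ (unitri φ y) = unitriGL φ y := Units.ext (unitri_unitri φ y)
    simp only [this]
  rw [himage]
  refine hs.image_of_continuousOn_injOn (continuous_mk_unitriGL φ w).continuousOn ?_
  intro y hy z hz h
  change unitri φ y = y at hy
  change unitri φ z = z at hz
  rw [← hy, ← hz]
  exact mk_unitriGL_injective hw h

end FlagTopology

/-! ### Products of tempered sequences acting on the Bruhat cell -/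

section Walk

lemma walk_succ_left {G : Type*} [Group G] (g : ℕ → G) (n : ℕ) :
    walk g (n + 1) = g 0 * walk (fun k => g (k + 1)) n := by
  induction n with
  | zero => simp [walk]
  | succ n ih => rw [walk, ih, walk, mul_assoc]

lemma map_walk {G H : Type*} [Group G] [Group H] (f : G →* H) (g : ℕ → G) (n : ℕ) :
    f (walk g n) = walk (fun k => f (g k)) n := by
  induction n with
  | zero => exact map_one f
  | succ n ih => rw [walk, map_mul, ih, walk]

lemma walk_mem {G : Type*} [Group G] {H : Subgroup G} {g : ℕ → G} (hg : ∀ n, g n ∈ H) (n : ℕ) :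
    walk g n ∈ H := by
  induction n with
  | zero => exact one_mem H
  | succ n ih => exact mul_mem ih (hg n)

variable {d : ℕ} {F : Type*} {φ : Fin d → ℝ} {w : Equiv.Perm (Fin d)}

lemma mk_walk_mul [Field F] (hw : ∀ i j, i < j → (w j < w i ↔ φ j ≤ φ i)) {γ : ℕ → GL (Fin d) F}
    (hγ : ∀ n, γ n ∈ upperTriangular d F) (b : Matrix (Fin d) (Fin d) F) (k m : ℕ) :
    (QuotientGroup.mk (walk (fun n => γ (n + m)) k * (unitriGL φ b * permGL F w)) :
      FlagManifold d F) = QuotientGroup.mk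
        (unitriGL φ (backward (cellStep φ fun n => (γ n : Matrix (Fin d) (Fin d) F))
          (fun _ => b) k m) * permGL F w) := by
  induction k generalizing m with
  | zero => rw [walk, one_mul, backward]
  | succ k ih =>
    have h1 := ih (m + 1)
    have h2 : (fun n => γ (n + (m + 1))) = fun n => γ (n + 1 + m) := by
      funext n
      congr 1
      ring
    rw [h2] at h1
    have h3 := mk_mul_permGL hw (mul_mem (hγ m) (unitriGL_mem φ
      (backward (cellStep φ fun n => (γ n : Matrix (Fin d) (Fin d) F)) (fun _ => b) k (m + 1))))
    have h4 := congrArg (γ m • ·) h1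
    simp only [MulAction.Quotient.smul_coe, smul_eq_mul] at h4
    rw [walk_succ_left, zero_add, mul_assoc, h4, ← mul_assoc, h3]
    rfl

lemma exists_tendsto_walk [NormedField F] [CompleteSpace F] {c : ℝ}
    (hw : ∀ i j, i < j → (w j < w i ↔ φ j ≤ φ i)) {γ : ℕ → GL (Fin d) F}
    (hγ : IsTempered φ c fun n => (γ n : Matrix (Fin d) (Fin d) F)) (hc : 0 < c) :
    ∃ z : Matrix (Fin d) (Fin d) F,
      Tendsto (fun n => unipPart φ ((walk γ n : GL (Fin d) F) : Matrix (Fin d) (Fin d) F)) atTop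
        (𝓝 z) ∧
      ∀ b ∈ bruhatCell F w, Tendsto (fun n => walk γ n • b) atTop
        (𝓝 (QuotientGroup.mk (unitriGL φ z * permGL F w) : FlagManifold d F)) := by
  obtain ⟨z, hz⟩ := exists_tendsto_backward hγ hc
  have hmem : ∀ n, γ n ∈ upperTriangular d F := fun n => hγ.upper n
  refine ⟨z, ?_, fun b hb => ?_⟩
  -- The base point `w` of the cell has coordinate `unitri φ 0 = 1`, so the coordinate of its image
  -- under the walk is `unipPart φ (walk γ n)`.
  · refine (hz (unitri φ 0) (unitri_unitri φ 0)).congr fun n => ?_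
    have hone : unitriGL φ (unitri φ (0 : Matrix (Fin d) (Fin d) F)) = 1 := by
      refine Units.ext ?_
      rw [coe_unitriGL, unitri_unitri, Units.val_one]
      ext i j
      simp only [unitri, Matrix.one_apply, Matrix.zero_apply, ite_self]
    have h1 := mk_walk_mul hw hmem (unitri φ 0) n 0
    rw [hone, one_mul, mk_mul_permGL hw (walk_mem (fun k => hmem (k + 0)) n)] at h1
    have h2 := mk_unitriGL_injective hw h1
    rw [unitri_unipPart, unitri_backward fun _ => unitri_unitri φ _] at h2
    exact h2.symm
  · rw [bruhatCell_eq_range hw] at hb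
    obtain ⟨y, rfl⟩ := hb
    have h1 := ((continuous_mk_unitriGL φ w).tendsto z).comp
      (hz (unitri φ y) (unitri_unitri φ y))
    refine h1.congr fun n => ?_
    have : unitriGL φ (unitri φ y) = unitriGL φ y := Units.ext (unitri_unitri φ y)
    rw [Function.comp_apply, ← mk_walk_mul hw hmem, this]
    rfl

end Walk

/-! ### Tempered sequences and averages -/

section Averages

lemma exists_bound_of_tendsto_div {s : ℕ → ℝ} {l : ℝ}
    (h : Tendsto (fun n : ℕ => s n / n) atTop (𝓝 l)) {ε : ℝ} (hε : 0 < ε) :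
    ∃ C, ∀ n : ℕ, |s n - l * n| ≤ C + ε * n := by
  obtain ⟨N, hN⟩ := Metric.tendsto_atTop.1 h ε hε
  refine ⟨∑ n ∈ Finset.range (N + 1), |s n - l * n|, fun n => ?_⟩
  have h0 : 0 ≤ ∑ n ∈ Finset.range (N + 1), |s n - l * n| :=
    Finset.sum_nonneg fun _ _ => abs_nonneg _
  rcases lt_or_ge N n with hn | hn
  · have hn0 : (0 : ℝ) < n := by exact_mod_cast (Nat.zero_le N).trans_lt hn
    have h1 := hN n hn.le
    rw [Real.dist_eq] at h1
    have h2 : s n - l * n = (s n / n - l) * n := by field_simp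
    rw [h2, abs_mul, abs_of_pos hn0]
    nlinarith
  · have h1 := Finset.single_le_sum (f := fun n : ℕ => |s n - l * n|) (fun _ _ => abs_nonneg _)
      (Finset.mem_range_succ_iff.2 hn)
    have h2 : 0 ≤ ε * n := by positivity
    linarith

/-- Each term is the difference of two consecutive partial sums, both of the form `l * n + o(n)`. -/
lemma exists_bound_of_tendsto_average {x : ℕ → ℝ} {l : ℝ}
    (h : Tendsto (fun n : ℕ => (∑ k ∈ Finset.range n, x k) / n) atTop (𝓝 l)) {ε : ℝ}
    (hε : 0 < ε) : ∃ C, ∀ n : ℕ, |x n| ≤ C + ε * n := by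
  obtain ⟨C, hC⟩ := exists_bound_of_tendsto_div h (half_pos hε)
  refine ⟨2 * C + ε + |l|, fun n => ?_⟩
  have h1 := hC n
  have h2 := hC (n + 1)
  rw [Finset.sum_range_succ] at h2
  push_cast at h2
  rw [abs_le] at h1 h2 ⊢
  have h3 := neg_abs_le l
  have h4 := le_abs_self l
  constructor <;> linarith [h1.1, h1.2, h2.1, h2.2]

lemma exists_exp_bound_of_tendsto_average {x y : ℕ → ℝ} {l : ℝ}
    (h : Tendsto (fun n : ℕ => (∑ k ∈ Finset.range n, x k) / n) atTop (𝓝 l))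
    (hy : ∀ n, y n ≤ Real.exp |x n|) : ∀ ε > 0, ∃ C, ∀ n : ℕ, y n ≤ C * Real.exp (ε * n) := by
  intro ε hε
  obtain ⟨C, hC⟩ := exists_bound_of_tendsto_average h hε
  refine ⟨Real.exp C, fun n => (hy n).trans ?_⟩
  rw [← Real.exp_add]
  exact Real.exp_le_exp.2 (hC n)

variable {d : ℕ} {F : Type*} [NormedField F] {φ : Fin d → ℝ}

lemma isTempered_of_tendsto {a : ℕ → Matrix (Fin d) (Fin d) F} {c : ℝ}
    (hup : ∀ m i j, j < i → a m i j = 0) (hdiag : ∀ m i, a m i i ≠ 0)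
    (hφ : ∀ i, Tendsto (fun n : ℕ => (∑ k ∈ Finset.range n, Real.log ‖a k i i‖) / n) atTop
      (𝓝 (φ i)))
    (hoff : ∀ i j, i < j → ∃ l, Tendsto (fun n : ℕ =>
      (∑ k ∈ Finset.range n, Real.posLog ‖a k i j‖) / n) atTop (𝓝 l))
    (hc : ∀ i j, φ i < φ j → c ≤ φ j - φ i) : IsTempered φ c a where
  upper := hup
  diag_ne_zero := hdiag
  entry i j := by
    rcases lt_trichotomy i j with h | rfl | h
    · obtain ⟨l, hl⟩ := hoff i j h
      refine ExpDecay.of_seq (exists_exp_bound_of_tendsto_average hl fun n => ?_)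
      rw [abs_of_nonneg Real.posLog_nonneg]
      rcases eq_or_ne (a n i j) 0 with h0 | h0
      · rw [h0, norm_zero]; positivity
      · calc ‖a n i j‖ = Real.exp (Real.log ‖a n i j‖) :=
            (Real.exp_log (norm_pos_iff.2 h0)).symm
          _ ≤ _ := Real.exp_le_exp.2 (le_max_right _ _)
    · refine ExpDecay.of_seq (exists_exp_bound_of_tendsto_average (hφ i) fun n => ?_)
      rw [← Real.exp_log (norm_pos_iff.2 (hdiag n i)), Real.log_exp]
      exact Real.exp_le_exp.2 (le_abs_self _)
    · simpa only [hup _ i j h] using ExpDecay.zero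
  inv_diag i := by
    refine ExpDecay.of_seq (exists_exp_bound_of_tendsto_average (hφ i) fun n => ?_)
    rw [norm_inv, ← Real.exp_log (norm_pos_iff.2 (hdiag n i)), Real.log_exp, ← Real.exp_neg]
    exact Real.exp_le_exp.2 (neg_le_abs _)
  rate i j hij h c' _ hc' := by
    set s : Fin d → ℕ → ℝ := fun i n => ∑ k ∈ Finset.range n, Real.log ‖a k i i‖ with hs
    -- The partial product of the ratios, corrected from its own rate `φ j - φ i` to the rate `c'`.
    -- The correction is nonnegative because `c' ≤ c ≤ φ j - φ i`, so the required inequality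
    -- between consecutive terms persists.
    refine ⟨fun m => Real.exp (s i m - s j m + (φ j - φ i - c') * m), fun m => Real.exp_pos _,
      fun m => ?_, fun ε hε => ?_⟩
    · rw [norm_div, ← Real.exp_log (norm_pos_iff.2 (hdiag m i)),
        ← Real.exp_log (norm_pos_iff.2 (hdiag m j)), ← Real.exp_sub, ← Real.exp_add]
      refine Real.exp_le_exp.2 ?_
      simp only [hs, Finset.sum_range_succ]
      push_cast
      linarith [hc i j h]
    · obtain ⟨C, hC⟩ := exists_bound_of_tendsto_div (hφ i) (half_pos hε)
      obtain ⟨D, hD⟩ := exists_bound_of_tendsto_div (hφ j) (half_pos hε)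
      refine ⟨Real.exp (C + D), fun m => ⟨?_, ?_⟩⟩
      · rw [← Real.exp_add]
        refine Real.exp_le_exp.2 ?_
        have h1 := (abs_le.1 (hC m)).2
        have h2 := (abs_le.1 (hD m)).1
        simp only [hs]
        linarith
      · rw [← Real.exp_neg, ← Real.exp_add]
        refine Real.exp_le_exp.2 ?_
        have h1 := (abs_le.1 (hC m)).1
        have h2 := (abs_le.1 (hD m)).2
        simp only [hs]
        linarith

/-- There are finitely many gaps, so every small enough `c > 0` works, even when no gap is positive.
-/
lemma exists_gap (φ : Fin d → ℝ) : ∃ c > 0, ∀ i j, φ i < φ j → c ≤ φ j - φ i := by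
  have h : ∀ q : Fin d × Fin d, ∀ᶠ c in 𝓝[>] (0 : ℝ), φ q.1 < φ q.2 → c ≤ φ q.2 - φ q.1 := by
    intro q
    by_cases hq : φ q.1 < φ q.2
    · filter_upwards [Ioo_mem_nhdsGT (sub_pos.2 hq)] with c hc _ using hc.2.le
    · exact Eventually.of_forall fun c h => absurd h hq
  obtain ⟨c, hc, hc0⟩ := ((eventually_all.2 h).and self_mem_nhdsWithin).exists
  exact ⟨c, hc0, fun i j => hc (i, j)⟩

end Averages

/-! ### Random walks on the flag manifold at one place -/

section OnePlace

lemma ae_tendsto_average {G : Type*} [MeasurableSpace G] (μ : Measure G) [IsProbabilityMeasure μ]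
    {X : G → ℝ} (hX : Integrable X μ) (hX' : Measurable X) :
    ∀ᵐ g ∂(Measure.infinitePi fun _ : ℕ => μ),
      Tendsto (fun n : ℕ => (∑ k ∈ Finset.range n, X (g k)) / n) atTop (𝓝 (∫ a, X a ∂μ)) := by
  have hmp : ∀ i : ℕ, MeasurePreserving (fun g : ℕ → G => g i)
      (Measure.infinitePi fun _ : ℕ => μ) μ :=
    fun i => measurePreserving_eval_infinitePi (fun _ : ℕ => μ) i
  have h := ProbabilityTheory.strong_law_ae_real (μ := Measure.infinitePi fun _ : ℕ => μ)
    (fun i g => X (g i)) ((hmp 0).integrable_comp_of_integrable hX) ?_ fun i => ?_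
  · have h0 : ∫ g : ℕ → G, X (g 0) ∂(Measure.infinitePi fun _ : ℕ => μ) = ∫ a, X a ∂μ := by
      have := integral_map (μ := Measure.infinitePi fun _ : ℕ => μ)
        (hmp 0).measurable.aemeasurable (f := X) hX'.aestronglyMeasurable
      rw [(hmp 0).map_eq] at this
      exact this.symm
    rwa [h0] at h
  · intro i j hij
    exact (ProbabilityTheory.iIndepFun_infinitePi (P := fun _ : ℕ => μ) (X := fun _ => X)
      fun _ => hX').indepFun hij
  · refine ⟨(hX'.comp (hmp i).measurable).aemeasurable,
      (hX'.comp (hmp 0).measurable).aemeasurable, ?_⟩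
    have key : ∀ i, Measure.map (fun g : ℕ → G => X (g i)) (Measure.infinitePi fun _ : ℕ => μ) =
        μ.map X := fun i => by
      have := Measure.map_map (μ := Measure.infinitePi fun _ : ℕ => μ) hX' (hmp i).measurable
      rw [(hmp i).map_eq] at this
      exact this.symm
    rw [key, key]

variable {d : ℕ} {K : Type*} [Field K] [NumberField K]

instance : DiscreteMeasurableSpace (upperTriangular d K) := ⟨fun _ => trivial⟩

lemma countable_numberField (K : Type*) [Field K] [NumberField K] : Countable K :=
  (Module.finBasis ℚ K).equivFun.injective.countable

instance : Countable (upperTriangular d K) := by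
  have := countable_numberField K
  have : Countable (Matrix (Fin d) (Fin d) K) :=
    inferInstanceAs (Countable (Fin d → Fin d → K))
  have : Countable (GL (Fin d) K) := Units.val_injective.countable
  exact Subtype.countable

lemma measurable_walk (n : ℕ) :
    Measurable fun g : ℕ → upperTriangular d K => walk g n := by
  induction n with
  | zero => exact measurable_const
  | succ n ih =>
    exact (Measurable.of_discrete (f := fun q : upperTriangular d K × upperTriangular d K =>
      q.1 * q.2)).comp (ih.prodMk (measurable_pi_apply n))

/-- The homomorphism from `A(K)` to `GL_d(F)` given by an embedding of `K` in `F`. -/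
def placeHom (d : ℕ) {F : Type*} [Field F] (ι : K →+* F) : upperTriangular d K →* GL (Fin d) F :=
  (Matrix.GeneralLinearGroup.map ι).comp (upperTriangular d K).subtype

lemma placeHom_apply {K F : Type*} [Field K] [Field F] (ι : K →+* F) (a : upperTriangular d K)
    (i j : Fin d) : (placeHom d ι a : Matrix (Fin d) (Fin d) F) i j = ι ((a : GL (Fin d) K) i j) :=
  rfl

lemma placeHom_mem {K F : Type*} [Field K] [Field F] (ι : K →+* F) (a : upperTriangular d K) :
    placeHom d ι a ∈ upperTriangular d F := fun i j h => by
  rw [placeHom_apply, a.2 i j h, map_zero]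

/-- From any point of the Bruhat cell, the random walk converges almost surely to a point of the
cell which does not depend on the starting point. -/
theorem exists_cell_limit {F : Type*} [NormedField F] [CompleteSpace F]
    [SecondCountableTopology F] (ι : K →+* F) (μ : Measure (upperTriangular d K))
    [IsProbabilityMeasure μ]
    (hdiag : ∀ i : Fin d, Integrable (fun a : upperTriangular d K =>
      Real.log ‖ι ((a : GL (Fin d) K) i i)‖) μ)
    (hoff : ∀ i j : Fin d, i < j → Integrable (fun a : upperTriangular d K =>
      Real.posLog ‖ι ((a : GL (Fin d) K) i j)‖) μ)
    {w : Equiv.Perm (Fin d)}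
    (hw : ∀ i j, i < j → (w j < w i ↔
      ∫ a : upperTriangular d K, Real.log ‖ι ((a : GL (Fin d) K) j j)‖ ∂μ ≤
        ∫ a : upperTriangular d K, Real.log ‖ι ((a : GL (Fin d) K) i i)‖ ∂μ)) :
    ∃ Z : (ℕ → upperTriangular d K) → FlagManifold d F,
      @Measurable _ _ _ (borel (FlagManifold d F)) Z ∧ (∀ g, Z g ∈ bruhatCell F w) ∧
      ∀ᵐ g ∂(Measure.infinitePi fun _ : ℕ => μ), ∀ b ∈ bruhatCell F w,
        Tendsto (fun n => placeHom d ι (walk g n) • b) atTop (𝓝 (Z g)) := by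
  set φ : Fin d → ℝ := fun i =>
    ∫ a : upperTriangular d K, Real.log ‖ι ((a : GL (Fin d) K) i i)‖ ∂μ with hφ
  obtain ⟨c, hc, hcφ⟩ := exists_gap φ
  have htemp : ∀ᵐ g ∂(Measure.infinitePi fun _ : ℕ => μ),
      IsTempered φ c fun n => (placeHom d ι (g n) : Matrix (Fin d) (Fin d) F) := by
    have h1 : ∀ᵐ g ∂(Measure.infinitePi fun _ : ℕ => μ), ∀ i : Fin d, _ :=
      ae_all_iff.2 fun i => ae_tendsto_average μ (hdiag i) .of_discrete
    have h2 : ∀ᵐ g ∂(Measure.infinitePi fun _ : ℕ => μ), ∀ i j : Fin d, ∀ _ : i < j, _ :=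
      ae_all_iff.2 fun i => ae_all_iff.2 fun j => ae_all_iff.2 fun h =>
        ae_tendsto_average μ (hoff i j h) .of_discrete
    filter_upwards [h1, h2] with g h1 h2
    exact isTempered_of_tendsto (fun m => placeHom_mem ι (g m))
      (fun m => diag_ne_zero_of_mem (placeHom_mem ι (g m))) h1 (fun i j h => ⟨_, h2 i j h⟩) hcφ
  have hlim : ∀ᵐ g ∂(Measure.infinitePi fun _ : ℕ => μ), ∃ z : Matrix (Fin d) (Fin d) F,
      Tendsto (fun n => unipPart φ (placeHom d ι (walk g n) : Matrix (Fin d) (Fin d) F)) atTop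
        (𝓝 z) ∧
      ∀ b ∈ bruhatCell F w, Tendsto (fun n => placeHom d ι (walk g n) • b) atTop
        (𝓝 (QuotientGroup.mk (unitriGL φ z * permGL F w) : FlagManifold d F)) := by
    filter_upwards [htemp] with g hg
    simp only [map_walk]
    exact exists_tendsto_walk hw hg hc
  let _ : MeasurableSpace (Matrix (Fin d) (Fin d) F) := borel _
  have : BorelSpace (Matrix (Fin d) (Fin d) F) := ⟨rfl⟩
  have : TopologicalSpace.PseudoMetrizableSpace (Matrix (Fin d) (Fin d) F) :=
    inferInstanceAs (TopologicalSpace.PseudoMetrizableSpace (Fin d → Fin d → F))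
  have : T2Space (Matrix (Fin d) (Fin d) F) := inferInstanceAs (T2Space (Fin d → Fin d → F))
  -- The measurable choice is made in the space of coordinates. Any value of `Y`, even off the
  -- convergence set, gives a point of the cell, so `Z` lies in the cell for every `g`.
  obtain ⟨Y, hY, hYlim⟩ := measurable_limit_of_tendsto_metrizable_ae
    (μ := Measure.infinitePi fun _ : ℕ => μ) (L := atTop)
    (f := fun n g => unipPart φ (placeHom d ι (walk g n) : Matrix (Fin d) (Fin d) F))
    (fun n => ((Measurable.of_discrete (f := fun x : upperTriangular d K =>
      unipPart φ (placeHom d ι x : Matrix (Fin d) (Fin d) F))).comp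
        (measurable_walk n)).aemeasurable)
    (hlim.mono fun g hg => ⟨hg.choose, hg.choose_spec.1⟩)
  refine ⟨fun g => QuotientGroup.mk (unitriGL φ (Y g) * permGL F w), ?_, fun g => ?_, ?_⟩
  · let _ : MeasurableSpace (FlagManifold d F) := borel _
    have : BorelSpace (FlagManifold d F) := ⟨rfl⟩
    exact (continuous_mk_unitriGL φ w).measurable.comp hY
  · exact ⟨_, unitriGL_mem φ (Y g), rfl⟩
  · filter_upwards [hlim, hYlim] with g hg hYg
    obtain ⟨z, hz, hz'⟩ := hg
    rwa [tendsto_nhds_unique hYg hz]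

end OnePlace

/-! ### Boundaries from pointwise limits -/

section Boundary

variable {G : Type*} [MeasurableSpace G] (μ : Measure G) [IsProbabilityMeasure μ]

/-- Adding a first term to a sequence. -/
def consSeq (q : G × (ℕ → G)) : ℕ → G
  | 0 => q.1
  | n + 1 => q.2 n

lemma measurable_consSeq : Measurable (consSeq : G × (ℕ → G) → ℕ → G) := by
  refine measurable_pi_iff.2 fun n => ?_
  cases n with
  | zero => exact measurable_fst
  | succ n => exact (measurable_pi_apply n).comp measurable_snd

lemma map_consSeq : (μ.prod (Measure.infinitePi fun _ : ℕ => μ)).map consSeq =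
    Measure.infinitePi fun _ : ℕ => μ := by
  refine Measure.eq_infinitePi _ fun s t ht => ?_
  classical
  -- Padding with `Set.univ` replaces the finite set `s` by an initial segment, on which the index
  -- `0` can be split off.
  set t' : ℕ → Set G := fun i => if i ∈ s then t i else Set.univ with ht'_def
  have ht' : ∀ i, MeasurableSet (t' i) := fun i => by
    simp only [ht'_def]
    split_ifs
    exacts [ht i, MeasurableSet.univ]
  set N := s.sup id with hN
  have hs : s ⊆ Finset.range (N + 1) := fun i hi =>
    Finset.mem_range_succ_iff.2 (Finset.le_sup (f := id) hi)
  have hset : consSeq ⁻¹' ((s : Set ℕ).pi t) =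
      t' 0 ×ˢ ((Finset.range N : Set ℕ).pi fun i => t' (i + 1)) := by
    ext q
    simp only [Set.mem_preimage, Set.mem_pi, Set.mem_prod, Finset.mem_coe, Finset.mem_range]
    constructor
    · intro h
      constructor
      · simp only [ht'_def]
        split_ifs with h0
        exacts [h 0 h0, trivial]
      · intro i _
        simp only [ht'_def]
        split_ifs with h0
        exacts [h (i + 1) h0, trivial]
    · rintro ⟨h0, h1⟩ i hi
      cases i with
      | zero => simpa [ht'_def, hi, consSeq] using h0
      | succ i =>
        have := h1 i (by have := Finset.mem_range.1 (hs hi); omega)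
        simpa [ht'_def, hi, consSeq] using this
  rw [Measure.map_apply measurable_consSeq
    (MeasurableSet.pi s.countable_toSet fun i _ => ht i), hset, Measure.prod_prod,
    Measure.infinitePi_pi _ (fun i _ => ht' (i + 1)), mul_comm,
    ← Finset.prod_range_succ' (fun i => μ (t' i)), ← Finset.prod_subset hs]
  · exact Finset.prod_congr rfl fun i hi => by simp [ht'_def, hi]
  · intro i _ hi
    simp [ht'_def, hi]

lemma measurePreserving_shift : MeasurePreserving (fun (g : ℕ → G) n => g (n + 1))
    (Measure.infinitePi fun _ : ℕ => μ) (Measure.infinitePi fun _ : ℕ => μ) :=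
  ⟨measurable_pi_iff.2 fun n => measurable_pi_apply (n + 1),
    Measure.map_infinitePi_infinitePi_of_inj (P := fun _ : ℕ => μ) (add_left_injective 1)⟩

variable [Group G] [Countable G] [DiscreteMeasurableSpace G] {B : Type*} [MulAction G B]
  [TopologicalSpace B] [T2Space B] [ContinuousConstSMul G B] [MeasurableSpace B] [BorelSpace B]

/-- If almost every trajectory of the random walk converges, from any point of a set `C`, to a
point `Z g` of `C`, then the law of `Z` makes the space a boundary. -/
theorem isMuBoundary_map_of_tendsto {Z : (ℕ → G) → B} (hZ : Measurable Z) {C : Set B}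
    (hC : MeasurableSet C) (hZC : ∀ g, Z g ∈ C)
    (hlim : ∀ᵐ g ∂(Measure.infinitePi fun _ : ℕ => μ), ∀ b ∈ C,
      Tendsto (fun n => walk g n • b) atTop (𝓝 (Z g)))
    {ν : ProbabilityMeasure B}
    (hν : (ν : Measure B) = (Measure.infinitePi fun _ : ℕ => μ).map Z) : IsMuBoundary μ ν where
  stationary s hs := by
    -- Both sides are limits of `walk g (n + 1) • b` for one `b` in `C`; the point `Z g` itself
    -- serves as `b`.
    have hequiv : ∀ᵐ g ∂(Measure.infinitePi fun _ : ℕ => μ),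
        Z g = g 0 • Z fun n => g (n + 1) := by
      filter_upwards [hlim, (measurePreserving_shift μ).quasiMeasurePreserving.ae hlim]
        with g h1 h2
      have h3 := (h1 _ (hZC g)).comp (tendsto_add_atTop_nat 1)
      have h4 := (h2 _ (hZC g)).const_smul (g 0)
      refine tendsto_nhds_unique h3 (h4.congr fun n => ?_)
      rw [Function.comp_apply, walk_succ_left, mul_smul]
    have hmeas : Measurable fun q : G × (ℕ → G) => q.1 • Z q.2 :=
      measurable_from_prod_countable_right fun a => (measurable_const_smul a).comp hZ
    have hae : (fun q : G × (ℕ → G) => Z (consSeq q)) =ᵐ[μ.prod (Measure.infinitePi fun _ => μ)]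
        fun q => q.1 • Z q.2 := by
      have : ∀ᵐ g ∂((μ.prod (Measure.infinitePi fun _ : ℕ => μ)).map consSeq),
          Z g = g 0 • Z fun n => g (n + 1) := by rwa [map_consSeq]
      exact ae_of_ae_map measurable_consSeq.aemeasurable this
    have hlaw : (Measure.infinitePi fun _ : ℕ => μ).map Z =
        (μ.prod (Measure.infinitePi fun _ : ℕ => μ)).map fun q => q.1 • Z q.2 := by
      rw [← Measure.map_congr hae]
      nth_rewrite 1 [← map_consSeq μ]
      exact Measure.map_map hZ measurable_consSeq
    rw [hν, hlaw, Measure.map_apply hmeas hs, Measure.prod_apply (hmeas hs)]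
    refine lintegral_congr fun a => ?_
    rw [translateMeasure, ProbabilityMeasure.toMeasure_map, hν,
      Measure.map_map (measurable_const_smul a) hZ,
      Measure.map_apply ((measurable_const_smul a).comp hZ) hs]
    rfl
  tendsto_dirac := by
    have hCae : ∀ᵐ b ∂(ν : Measure B), b ∈ C := by
      rw [hν]
      exact (ae_map_iff hZ.aemeasurable hC).2 (Eventually.of_forall hZC)
    filter_upwards [hlim] with g hg
    refine ⟨Z g, ?_⟩
    refine ProbabilityMeasure.tendsto_iff_forall_integral_tendsto.2 fun f => ?_
    have hf : StronglyMeasurable f := f.continuous.measurable.stronglyMeasurable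
    have hint : ∀ n, ∫ b, f b ∂(translateMeasure (walk g n) ν : Measure B) =
        ∫ b, f (walk g n • b) ∂(ν : Measure B) := by
      intro n
      rw [translateMeasure, ProbabilityMeasure.toMeasure_map,
        integral_map (measurable_const_smul (walk g n)).aemeasurable hf.aestronglyMeasurable]
    have hdirac : ∫ b, f b ∂(Measure.dirac (Z g)) = ∫ _, f (Z g) ∂(ν : Measure B) := by
      rw [integral_dirac' _ _ hf]
      simp
    change Tendsto _ _ (𝓝 (∫ b, f b ∂(Measure.dirac (Z g))))
    rw [hdirac]
    simp only [hint]
    refine tendsto_integral_of_dominated_convergence (fun _ => ‖f‖)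
      (fun n => (hf.comp_measurable (measurable_const_smul (walk g n))).aestronglyMeasurable)
      (integrable_const _) (fun n => Eventually.of_forall fun b => f.norm_coe_le_norm _) ?_
    filter_upwards [hCae] with b hb
    exact (f.continuous.tendsto _).comp (hg b hb)

end Boundary

/-! ### Countability and completions of number fields -/

section Completions

lemma countable_ideal (R : Type*) [CommRing R] [IsNoetherianRing R] [Countable R] :
    Countable (Ideal R) := by
  refine Function.Surjective.countable (f := fun s : Finset R => Ideal.span (s : Set R)) fun I => ?_
  obtain ⟨s, hs⟩ := (isNoetherianRing_iff_ideal_fg R).1 ‹_› I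
  exact ⟨s, hs⟩

variable (K : Type*) [Field K] [NumberField K]

/-- Needed to intersect the almost sure events over all places, and to identify the Borel σ-algebra
of the product with the product σ-algebra. -/
instance : Countable (HeightOneSpectrum (𝓞 K)) := by
  have := countable_numberField K
  have : Countable (𝓞 K) := RingOfIntegers.coe_injective.countable
  have := countable_ideal (𝓞 K)
  exact Function.Injective.countable (f := HeightOneSpectrum.asIdeal)
    fun _ _ h => HeightOneSpectrum.ext h

lemma secondCountableTopology_of_denseRange {K F : Type*} [Countable K] [NormedField F]
    {f : K → F} (hf : DenseRange f) : SecondCountableTopology F := by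
  have : TopologicalSpace.SeparableSpace F := ⟨Set.range f, Set.countable_range f, hf⟩
  exact UniformSpace.secondCountable_of_separable F

instance (p : HeightOneSpectrum (𝓞 K)) : SecondCountableTopology (p.adicCompletion K) := by
  have := countable_numberField K
  exact secondCountableTopology_of_denseRange (HeightOneSpectrum.denseRange_algebraMap K p)

lemma denseRange_infinitePlace {K : Type*} [Field K] (v : InfinitePlace K) :
    DenseRange (algebraMap K v.Completion) := by
  have h : DenseRange fun x : K => (((WithAbs.equiv v.1).symm x : WithAbs v.1) : v.Completion) :=
    (InfinitePlace.Completion.denseRange_coe v).comp (WithAbs.equiv v.1).symm.surjective.denseRange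
      ((InfinitePlace.Completion.continuous_ofCompletion v).comp
        (UniformSpace.Completion.continuous_coe _))
  exact h

instance (v : InfinitePlace K) : SecondCountableTopology v.Completion := by
  have := countable_numberField K
  exact secondCountableTopology_of_denseRange (denseRange_infinitePlace v)

lemma norm_algebraMap_infinitePlace {K : Type*} [Field K] (v : InfinitePlace K) (x : K) :
    ‖algebraMap K v.Completion x‖ = v x :=
  InfinitePlace.Completion.norm_coe v _

lemma norm_algebraMap_adicCompletion (p : HeightOneSpectrum (𝓞 K)) (x : K) :
    ‖algebraMap K (p.adicCompletion K) x‖ = NumberField.HeightOneSpectrum.adicAbv K p x :=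
  FinitePlace.norm_embedding p x

end Completions

/-! ### The boundary -/

section Main

variable {d : ℕ} {K : Type*} [Field K] [NumberField K]

/-- `exists_cell_limit` for a function `N` that is a power of the absolute value. -/
theorem exists_cell_limit_of_log_eq {F : Type*} [NormedField F] [CompleteSpace F]
    [SecondCountableTopology F] (ι : K →+* F) (μ : Measure (upperTriangular d K))
    [IsProbabilityMeasure μ] {N : K → ℝ} {κ : ℝ} (hκ : 0 < κ)
    (hN : ∀ x, Real.log (N x) = κ * Real.log ‖ι x‖)
    (hdiag : ∀ i : Fin d, Integrable (fun a : upperTriangular d K =>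
      Real.log (N ((a : GL (Fin d) K) i i))) μ)
    (hoff : ∀ i j : Fin d, i < j → Integrable (fun a : upperTriangular d K =>
      Real.posLog (N ((a : GL (Fin d) K) i j))) μ)
    {w : Equiv.Perm (Fin d)}
    (hw : ∀ i j, i < j → (w j < w i ↔
      ∫ a : upperTriangular d K, Real.log (N ((a : GL (Fin d) K) j j)) ∂μ ≤
        ∫ a : upperTriangular d K, Real.log (N ((a : GL (Fin d) K) i i)) ∂μ)) :
    ∃ Z : (ℕ → upperTriangular d K) → FlagManifold d F,
      @Measurable _ _ _ (borel (FlagManifold d F)) Z ∧ (∀ g, Z g ∈ bruhatCell F w) ∧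
      ∀ᵐ g ∂(Measure.infinitePi fun _ : ℕ => μ), ∀ b ∈ bruhatCell F w,
        Tendsto (fun n => placeHom d ι (walk g n) • b) atTop (𝓝 (Z g)) := by
  have hpos : ∀ x, Real.posLog (N x) = κ * Real.posLog ‖ι x‖ := fun x => by
    rw [Real.posLog, Real.posLog, hN, mul_max_of_nonneg _ _ hκ.le, mul_zero]
  -- A positive factor `κ` changes neither integrability nor the order of the means, hence the same
  -- `w`.
  simp only [hN, hpos, integral_const_mul, mul_le_mul_iff_right₀ hκ] at hdiag hoff hw
  have hunit : IsUnit κ := hκ.ne'.isUnit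
  exact exists_cell_limit ι μ (fun i => (integrable_const_mul_iff hunit _).1 (hdiag i))
    (fun i j h => (integrable_const_mul_iff hunit _).1 (hoff i j h)) hw

lemma bruhatPerm_spec (φ : Fin d → ℝ) :
    ∀ i j, i < j → (bruhatPerm φ j < bruhatPerm φ i ↔ φ j ≤ φ i) :=
  (existsUnique_bruhatPerm φ).choose_spec.1

end Main

end

theorem proposition1 (d : ℕ) (K : Type*) [Field K] [NumberField K]
    (μ : Measure (upperTriangular d K)) [IsProbabilityMeasure μ]
    (hdiag : ∀ (v : HeightOneSpectrum (𝓞 K) ⊕ InfinitePlace K) (i : Fin d),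
      Integrable (fun a : upperTriangular d K =>
        Real.log (placeAbs v ((a : GL (Fin d) K) i i))) μ)
    (hoff : ∀ (v : HeightOneSpectrum (𝓞 K) ⊕ InfinitePlace K) (i j : Fin d), i < j →
      Integrable (fun a : upperTriangular d K =>
        Real.posLog (placeAbs v ((a : GL (Fin d) K) i j))) μ) :
    ∃ ν : ProbabilityMeasure (FlagProduct d K),
      IsMuBoundary μ ν ∧
      ∀ᵐ b ∂(ν : Measure (FlagProduct d K)),
        (∀ p : HeightOneSpectrum (𝓞 K), b.1 p ∈ finiteCell μ p) ∧
        (∀ v : InfinitePlace K, b.2 v ∈ infiniteCell μ v) := by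
  have hfin : ∀ p : HeightOneSpectrum (𝓞 K), ∃ Z : (ℕ → upperTriangular d K) →
      FlagManifold d (p.adicCompletion K), @Measurable _ _ _ (borel _) Z ∧
      (∀ g, Z g ∈ finiteCell μ p) ∧
      ∀ᵐ g ∂(Measure.infinitePi fun _ : ℕ => μ), ∀ b ∈ finiteCell μ p,
        Tendsto (fun n => placeHom d (algebraMap K (p.adicCompletion K)) (walk g n) • b) atTop
          (𝓝 (Z g)) := fun p =>
    exists_cell_limit_of_log_eq (algebraMap K (p.adicCompletion K)) μ one_pos
      (fun x => by rw [norm_algebraMap_adicCompletion, one_mul]; rfl)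
      (hdiag (.inl p)) (hoff (.inl p)) (bruhatPerm_spec (phi μ (.inl p)))
  have hinf : ∀ v : InfinitePlace K, ∃ Z : (ℕ → upperTriangular d K) →
      FlagManifold d v.Completion, @Measurable _ _ _ (borel _) Z ∧
      (∀ g, Z g ∈ infiniteCell μ v) ∧
      ∀ᵐ g ∂(Measure.infinitePi fun _ : ℕ => μ), ∀ b ∈ infiniteCell μ v,
        Tendsto (fun n => placeHom d (algebraMap K v.Completion) (walk g n) • b) atTop
          (𝓝 (Z g)) := fun v =>
    exists_cell_limit_of_log_eq (algebraMap K v.Completion) μ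
      -- At a complex place the normalized absolute value is the square of the norm of the
      -- completion.
      (κ := v.mult) (by exact_mod_cast v.mult_pos)
      (fun x => by rw [norm_algebraMap_infinitePlace, ← Real.log_pow]; rfl)
      (hdiag (.inr v)) (hoff (.inr v)) (bruhatPerm_spec (phi μ (.inr v)))
  choose Zf hZf hZfC hZflim using hfin
  choose Zi hZi hZiC hZilim using hinf
  let _ : ∀ p : HeightOneSpectrum (𝓞 K), MeasurableSpace (FlagManifold d (p.adicCompletion K)) :=
    fun p => borel _
  have : ∀ p : HeightOneSpectrum (𝓞 K), BorelSpace (FlagManifold d (p.adicCompletion K)) :=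
    fun p => ⟨rfl⟩
  have : ∀ p : HeightOneSpectrum (𝓞 K),
      SecondCountableTopology (FlagManifold d (p.adicCompletion K)) :=
    fun p => secondCountableTopology_flagManifold
  have : ∀ p : HeightOneSpectrum (𝓞 K), T2Space (FlagManifold d (p.adicCompletion K)) :=
    fun p => t2Space_flagManifold
  let _ : ∀ v : InfinitePlace K, MeasurableSpace (FlagManifold d v.Completion) := fun v => borel _
  have : ∀ v : InfinitePlace K, BorelSpace (FlagManifold d v.Completion) := fun v => ⟨rfl⟩
  have : ∀ v : InfinitePlace K, SecondCountableTopology (FlagManifold d v.Completion) :=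
    fun v => secondCountableTopology_flagManifold
  have : ∀ v : InfinitePlace K, T2Space (FlagManifold d v.Completion) :=
    fun v => t2Space_flagManifold
  have hborel : (borel (FlagProduct d K)) = (inferInstance : MeasurableSpace
      ((∀ p : HeightOneSpectrum (𝓞 K), FlagManifold d (p.adicCompletion K)) ×
        (∀ v : InfinitePlace K, FlagManifold d v.Completion))) :=
    (inferInstance : BorelSpace
      ((∀ p : HeightOneSpectrum (𝓞 K), FlagManifold d (p.adicCompletion K)) ×
        (∀ v : InfinitePlace K, FlagManifold d v.Completion))).measurable_eq.symm
  have hT2 : T2Space (FlagProduct d K) := inferInstanceAs (T2Space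
      ((∀ p : HeightOneSpectrum (𝓞 K), FlagManifold d (p.adicCompletion K)) ×
        (∀ v : InfinitePlace K, FlagManifold d v.Completion)))
  -- The same trajectory `g` drives all the places; no independence between the components is
  -- claimed.
  set Z : (ℕ → upperTriangular d K) → FlagProduct d K :=
    fun g => (fun p => Zf p g, fun v => Zi v g) with hZ_def
  have hZ : Measurable Z := by
    change @Measurable _ _ _ (borel (FlagProduct d K)) Z
    rw [hborel]
    exact (measurable_pi_iff.2 hZf).prodMk (measurable_pi_iff.2 hZi)
  set C : Set (FlagProduct d K) := {b | (∀ p : HeightOneSpectrum (𝓞 K), b.1 p ∈ finiteCell μ p) ∧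
    ∀ v : InfinitePlace K, b.2 v ∈ infiniteCell μ v} with hC_def
  have hC : MeasurableSet C := by
    change MeasurableSet[borel (FlagProduct d K)] C
    have hinter : C = (⋂ p, (fun b : FlagProduct d K => b.1 p) ⁻¹' finiteCell μ p) ∩
        ⋂ v, (fun b : FlagProduct d K => b.2 v) ⁻¹' infiniteCell μ v := by
      ext b
      simp [hC_def]
    rw [hborel, hinter]
    refine MeasurableSet.inter ?_ ?_
    · exact MeasurableSet.iInter fun p => ((measurable_pi_apply p).comp measurable_fst)
        (measurableSet_bruhatCell (bruhatPerm_spec (phi μ (.inl p))))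
    · exact MeasurableSet.iInter fun v => ((measurable_pi_apply v).comp measurable_snd)
        (measurableSet_bruhatCell (bruhatPerm_spec (phi μ (.inr v))))
  have hZC : ∀ g, Z g ∈ C := fun g => ⟨fun p => hZfC p g, fun v => hZiC v g⟩
  have hlim : ∀ᵐ g ∂(Measure.infinitePi fun _ : ℕ => μ), ∀ b ∈ C,
      Tendsto (fun n => walk g n • b) atTop (𝓝 (Z g)) := by
    filter_upwards [ae_all_iff.2 hZflim, ae_all_iff.2 hZilim] with g h1 h2 b hb
    exact Tendsto.prodMk_nhds (tendsto_pi_nhds.2 fun p => h1 p _ (hb.1 p))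
      (tendsto_pi_nhds.2 fun v => h2 v _ (hb.2 v))
  let ν : ProbabilityMeasure (FlagProduct d K) :=
    ⟨(Measure.infinitePi fun _ : ℕ => μ).map Z, Measure.isProbabilityMeasure_map hZ.aemeasurable⟩
  exact ⟨ν, isMuBoundary_map_of_tendsto μ hZ hC hZC hlim rfl,
    (ae_map_iff hZ.aemeasurable hC).2 (Eventually.of_forall hZC)⟩
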